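/- Let $L>0$, $N,d\in\mathbb N$, $\beta>0$, let $\mathcal M=(L\mathbb T)^{dN}$ with $\mathbb T=\mathbb R/\mathbb Z$ (functions on $\mathcal M$ being identified with $L$-periodic functions on $\mathbb R^{dN}$), let $V\in C^\infty(\mathcal M)$, and set $$\mathcal L=-\beta\nabla V\cdot\nabla+\Delta,\qquad \mu(dq)=Z^{-1}e^{-\beta V(q)}\,dq,\qquad Z=\int_{\mathcal M}e^{-\beta V}.$$ For $\Delta t>0$ and $q,q'\in\mathbb R^{dN}$ let $$T_{\Delta t}(q,q')=\Big(\frac1{4\pi\Delta t}\Big)^{dN/2}\exp\Big(-\frac{|q'-q+\beta\Delta t\nabla V(q)|^2}{4\Delta t}\Big),\qquad R_{\Delta t}(q,q')=\min\Big(\frac{e^{-\beta V(q')}T_{\Delta t}(q',q)}{e^{-\beta V(q)}T_{\Delta t}(q,q')},1\Big).$$ The Metropolized Euler--Maruyama scheme moves $q\in\mathcal M$ (seen as an element of $\mathbb R^{dN}$) to $\widetilde q=q-\beta\Delta t\nabla V(q)+\sqrt{2\Delta t}\,G$, projected into $\mathcal M$, if $U\le R_{\Delta t}(q,\widetilde q)$,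 and leaves $q$ unchanged otherwise, where $G$ is a standard Gaussian vector in $\mathbb R^{dN}$ and $U$ is uniform on $[0,1]$ and independent of $G$. Let $P_{\Delta t}f(q)$ be the expectation of $f$ at the new position when the scheme starts from $q$. (i) There exist a linear operator $A:C^\infty(\mathcal M)\to C^\infty(\mathcal M)$ and $\Delta t^*>0$ such that, for every $\psi\in C^\infty(\mathcal M)$ and every $0<\Delta t\le\Delta t^*$, $$P_{\Delta t}\psi=\psi+\Delta t\,\mathcal L\psi+\Delta t^2A\psi+\Delta t^{5/2}r_{\psi,\Delta t},$$ where $|r_{\psi,\Delta t}(q)|$ is bounded uniformly in $q\in\mathcal M$ and $0<\Delta t\le\Delta t^*$ (the bound may depend on $\psi$). Moreover $\int_{\mathcal M}A\psi\,d\mu=0$ for every $\psi\in C^\infty(\mathcal M)$. (ii) There exists a measurable function $\xi_+:\mathcal M\times\mathbb R^{dN}\to[0,\infty)$, with $\xi_+(q,G)$ integrable for every $q$, such that $\overline\xi(q)=\mathbb E_G[\xi_+(q,G)]$ is a bounded function of $q\in\mathcal M$ and such that, for every $p\in\mathbb N$, there exist $C_p\ge0$ and $\Delta t_p^*>0$ for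 which, writing $\widetilde q=q-\beta\Delta t\nabla V(q)+\sqrt{2\Delta t}\,G$, for all $0<\Delta t\le\Delta t_p^*$ and all $q\in\mathcal M$, $$\mathbb E_G\Big|R_{\Delta t}(q,\widetilde q)-1+\Delta t^{3/2}\,\xi_+(q,G)\Big|^p\le C_p\,\Delta t^{2p}\qquad\text{and}\qquad\Big|\mathbb E_G\big[R_{\Delta t}(q,\widetilde q)\big]-1+\Delta t^{3/2}\,\overline\xi(q)\Big|^p\le C_p\,\Delta t^{2p}.$$ In particular the average rejection rate $1-\mathbb E_G[R_{\Delta t}(q,\widetilde q)]$ equals $\Delta t^{3/2}\,\overline\xi(q)+O(\Delta t^2)$, uniformly in $q$. -/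

import Mathlib

open MeasureTheory ProbabilityTheory

noncomputable section

namespace MetropolizedEM

/-- The ambient Euclidean space `ℝ^{dN}` of the positions of `N` particles in dimension `d`. -/
abbrev Ambient (N d : ℕ) : Type := EuclideanSpace ℝ (Fin N × Fin d)

/-- The periodic position space `(L𝕋)^{dN}`, where `L𝕋 = ℝ / Lℤ`. -/
abbrev Torus (L : ℝ) (N d : ℕ) : Type := Fin N × Fin d → AddCircle L

variable {L : ℝ} {N d : ℕ}

/-- The projection of `ℝ^{dN}` onto the periodic box. -/
def proj (L : ℝ) {N d : ℕ} (x : Ambient N d) : Torus L N d := fun i => (x i : AddCircle L)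

/-- A point of the periodic box seen as an element of `ℝ^{dN}`: its representative
in `[0, L)^{dN}`. -/
def rep [Fact (0 < L)] (q : Torus L N d) : Ambient N d :=
  WithLp.toLp 2 fun i => (AddCircle.equivIco L 0 (q i) : ℝ)

/-- A function on the periodic box, seen as a periodic function on `ℝ^{dN}`. -/
def lift (f : Torus L N d → ℝ) : Ambient N d → ℝ := fun x => f (proj L x)

/-- The space `C^∞` of smooth real functions on the periodic box. -/
def smoothFunctions (L : ℝ) (N d : ℕ) : Submodule ℝ (Torus L N d → ℝ) where
  carrier := {f | ContDiff ℝ (⊤ : ℕ∞) (lift f)}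
  add_mem' {f g} hf hg := by
    change ContDiff ℝ (⊤ : ℕ∞) (fun x => lift f x + lift g x)
    exact ContDiff.add hf hg
  zero_mem' := by
    change ContDiff ℝ (⊤ : ℕ∞) (fun _ : Ambient N d => (0 : ℝ))
    exact contDiff_const
  smul_mem' c f hf := by
    change ContDiff ℝ (⊤ : ℕ∞) (fun x => c * lift f x)
    exact contDiff_const.mul hf

/-- The gradient of a function on the periodic box. -/
def grad [Fact (0 < L)] (f : Torus L N d → ℝ) (q : Torus L N d) : Ambient N d :=
  gradient (lift f) (rep q)

/-- The generator `-β ∇V · ∇ + Δ`. -/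
def generator [Fact (0 < L)] (β : ℝ) (V f : Torus L N d → ℝ) (q : Torus L N d) : ℝ :=
  -β * inner ℝ (grad V q) (grad f q) + Laplacian.laplacian (lift f) (rep q)

/-- The normalization constant `Z = ∫ exp (-β V)`. -/
def partitionFunction [Fact (0 < L)] (β : ℝ) (V : Torus L N d → ℝ) : ℝ :=
  ∫ q, Real.exp (-β * V q)

/-- The Boltzmann-Gibbs measure `Z⁻¹ exp (-β V(q)) dq`. -/
def gibbs [Fact (0 < L)] (β : ℝ) (V : Torus L N d → ℝ) : Measure (Torus L N d) :=
  volume.withDensity fun q =>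
    ENNReal.ofReal ((partitionFunction β V)⁻¹ * Real.exp (-β * V q))

/-- The Gaussian transition density `T_Δt(x, y)` of the Euler-Maruyama scheme on `ℝ^{dN}`. -/
def transitionDensity (β : ℝ) (V : Torus L N d → ℝ) (dt : ℝ) (x y : Ambient N d) : ℝ :=
  (1 / (4 * Real.pi * dt)) ^ (((d * N : ℕ) : ℝ) / 2) *
    Real.exp (-(‖y - x + (β * dt) • gradient (lift V) x‖ ^ 2 / (4 * dt)))

/-- The Metropolis acceptance probability `R_Δt(x, y)`. -/
def acceptance (β : ℝ) (V : Torus L N d → ℝ) (dt : ℝ) (x y : Ambient N d) : ℝ :=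
  min (Real.exp (-β * lift V y) * transitionDensity β V dt y x /
      (Real.exp (-β * lift V x) * transitionDensity β V dt x y)) 1

/-- The increment `-β Δt ∇V(q) + √(2 Δt) g` proposed by the Euler-Maruyama scheme. -/
def increment [Fact (0 < L)] (β : ℝ) (V : Torus L N d → ℝ) (dt : ℝ)
    (q : Torus L N d) (g : Ambient N d) : Ambient N d :=
  -((β * dt) • grad V q) + √(2 * dt) • g

/-- The probability `R_Δt(q, q - β Δt ∇V(q) + √(2 Δt) g)` of accepting the proposal made
from `q` with the Gaussian increment `g`; the proposal is not reprojected into the box. -/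
def proposalAcceptance [Fact (0 < L)] (β : ℝ) (V : Torus L N d → ℝ) (dt : ℝ)
    (q : Torus L N d) (g : Ambient N d) : ℝ :=
  acceptance β V dt (rep q) (rep q + increment β V dt q g)

open Classical in
/-- One step of the Metropolized Euler-Maruyama scheme from `q`, with Gaussian increment `g`
and uniform variable `u`: the new position is projected into the periodic box. -/
def step [Fact (0 < L)] (β : ℝ) (V : Torus L N d → ℝ) (dt : ℝ)
    (q : Torus L N d) (g : Ambient N d) (u : ℝ) : Torus L N d :=
  if u ≤ proposalAcceptance β V dt q g then q + proj L (increment β V dt q g) else q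

/-- The evolution operator `P_Δt f (q) = 𝔼 (f (q^{n+1}) | q^n = q)` of the scheme, the
expectation being over a standard Gaussian `g` in `ℝ^{dN}` and an independent uniform variable
`u` in `[0, 1]`. -/
def evolution [Fact (0 < L)] (β : ℝ) (V : Torus L N d → ℝ) (dt : ℝ)
    (f : Torus L N d → ℝ) (q : Torus L N d) : ℝ :=
  ∫ z, f (step β V dt q z.1 z.2)
    ∂((stdGaussian (Ambient N d)).prod (volume.restrict (Set.Icc (0 : ℝ) 1)))

end MetropolizedEM

end

open MeasureTheory ProbabilityTheory

set_option linter.unusedSectionVars false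
set_option linter.unusedVariables false

/-! Put `s = √Δt` and let `y` be the proposed increment. Once the common Gaussian factors cancel,
the logarithm of the Metropolis ratio is `-β` times the error of the trapezoidal rule for `V` along
the segment `[x, x + y]`, plus `Δt` times an increment of `|∇V|²`. The trapezoidal error starts at
third order, and `y` is `√2 s g` up to `O(s²)`, so the logarithm is `s³ ζ(x, g) + O(s⁴)` with `ζ`
odd in `g` (`logRatio_expansion`). Since `min(eᵃ, 1) = 1 - max(-a, 0) + O(a²)`, the rejection
probability is `s³ max(-ζ, 0) + O(s⁴)`, with polynomial growth in `g` (`acceptance_expansion`).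
Gaussian moments then give (ii) with `ξ₊ = max(-ζ, 0)`.

For (i), integrating out the uniform variable gives `P f - f = 𝔼[(f(x + y) - f(x)) R]`. Writing `R =
1 + (R - 1)` separates the Euler-Maruyama expansion (`euler_expansion`) from a correction of order
`s · s³ = s⁴` (`rejection_expansion`). That correction involves `𝔼[ℓ(g) max(-ζ, 0)]` with `ℓ`
linear. As `max(-ζ, 0) = (|ζ| - ζ) / 2` and `ζ` is odd, the nonsmooth part `|ζ|` averages to zero.
What remains is linear in derivatives of `V` and of `|∇V|²`, so `A` preserves smoothness.

Finally, detailed balance makes the Gibbs measure invariant for every `Δt` (`evolution_invariant`).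
Integrating the expansion gives `s² ∫ℒψ + s⁴ ∫Aψ = O(s⁵)`, which forces both coefficients to vanish
(`integral_secondOrder`). -/

namespace MetropolizedEM

/-! ### Smooth periodic functions on the ambient space: closure properties, uniform bounds, Taylor's
formula. -/

section Periodic

variable {L : ℝ} {N d : ℕ} {G H : Type*} [NormedAddCommGroup G] [NormedSpace ℝ G]
  [NormedAddCommGroup H] [NormedSpace ℝ H]

/-- Smooth functions on `ℝ^{dN}` that are periodic with respect to the lattice `L ℤ^{dN}`. -/
structure SmoothPeriodic (L : ℝ) {N d : ℕ} (f : Ambient N d → G) : Prop where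
  contDiff : ContDiff ℝ (⊤ : ℕ∞) f
  periodic : ∀ x k, proj L k = 0 → f (x + k) = f x

lemma proj_add (x y : Ambient N d) : proj L (x + y) = proj L x + proj L y := by
  funext i
  simp [proj]

lemma proj_neg (x : Ambient N d) : proj L (-x) = -proj L x := by
  funext i
  simp [proj]

lemma measurable_proj : Measurable (proj L : Ambient N d → Torus L N d) := by
  unfold proj
  exact measurable_pi_lambda _ fun i => AddCircle.measurable_mk'.comp (by fun_prop)

lemma proj_rep [Fact (0 < L)] (q : Torus L N d) : proj L (rep q) = q := by
  funext i
  simp only [proj, rep]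
  exact AddCircle.coe_equivIco

lemma measurable_rep [Fact (0 < L)] :
    Measurable (rep : Torus L N d → Ambient N d) := by
  unfold rep
  refine (WithLp.measurable_toLp 2 _).comp (measurable_pi_lambda _ fun i => ?_)
  exact measurable_subtype_coe.comp
    ((AddCircle.measurableEquivIco L 0).measurable.comp (measurable_pi_apply i))

namespace SmoothPeriodic

variable {f g : Ambient N d → G}

lemma differentiable (hf : SmoothPeriodic L f) : Differentiable ℝ f :=
  hf.contDiff.differentiable (by simp)

lemma continuous (hf : SmoothPeriodic L f) : Continuous f := hf.contDiff.continuous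

lemma contDiff_nat (hf : SmoothPeriodic L f) (n : ℕ) : ContDiff ℝ n f :=
  hf.contDiff.of_le (by exact_mod_cast le_top)

lemma eq_of_proj_eq (hf : SmoothPeriodic L f) {x y : Ambient N d} (h : proj L x = proj L y) :
    f x = f y := by
  have := hf.periodic y (x - y) (by rw [sub_eq_add_neg, proj_add, proj_neg, h, add_neg_cancel])
  rwa [add_sub_cancel] at this

lemma apply_rep_proj [Fact (0 < L)] (hf : SmoothPeriodic L f) (x : Ambient N d) :
    f (rep (proj L x)) = f x :=
  hf.eq_of_proj_eq (proj_rep _)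

/-- Every value is attained on the compact cube `[0, L]^{dN}`, which contains the representatives.
All constants uniform in the base point come from here. -/
lemma bounded [Fact (0 < L)] (hf : SmoothPeriodic L f) : ∃ C, 0 ≤ C ∧ ∀ x, ‖f x‖ ≤ C := by
  obtain ⟨C, hC⟩ := (isCompact_univ_pi fun _ : Fin N × Fin d =>
    isCompact_Icc (a := (0 : ℝ)) (b := L)).exists_bound_of_continuousOn
      (f := fun v => f (WithLp.toLp 2 v))
      (hf.continuous.comp (PiLp.continuous_toLp 2 _)).continuousOn
  have key : ∀ x, ‖f x‖ ≤ C := by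
    intro x
    rw [← hf.apply_rep_proj x]
    refine hC _ fun i _ => ?_
    have := (AddCircle.equivIco L 0 (proj L x i)).2
    exact ⟨this.1, by simpa using this.2.le⟩
  exact ⟨C, (norm_nonneg _).trans (key 0), key⟩

lemma add (hf : SmoothPeriodic L f) (hg : SmoothPeriodic L g) :
    SmoothPeriodic L (fun x => f x + g x) :=
  ⟨hf.contDiff.add hg.contDiff, fun x k hk => by rw [hf.periodic x k hk, hg.periodic x k hk]⟩

lemma sub (hf : SmoothPeriodic L f) (hg : SmoothPeriodic L g) :
    SmoothPeriodic L (fun x => f x - g x) :=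
  ⟨hf.contDiff.sub hg.contDiff, fun x k hk => by rw [hf.periodic x k hk, hg.periodic x k hk]⟩

lemma const_smul (c : ℝ) (hf : SmoothPeriodic L f) : SmoothPeriodic L (fun x => c • f x) :=
  ⟨contDiff_const.smul hf.contDiff, fun x k hk => by rw [hf.periodic x k hk]⟩

lemma clm_comp (T : G →L[ℝ] H) (hf : SmoothPeriodic L f) : SmoothPeriodic L (fun x => T (f x)) :=
  ⟨T.contDiff.comp hf.contDiff, fun x k hk => by rw [hf.periodic x k hk]⟩

lemma clm_apply {T : Ambient N d → G →L[ℝ] H} (hT : SmoothPeriodic L T)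
    (hf : SmoothPeriodic L f) : SmoothPeriodic L (fun x => T x (f x)) :=
  ⟨hT.contDiff.clm_apply hf.contDiff, fun x k hk => by
    rw [hf.periodic x k hk, hT.periodic x k hk]⟩

lemma norm_sq {f : Ambient N d → Ambient N d} (hf : SmoothPeriodic L f) :
    SmoothPeriodic L (fun x => ‖f x‖ ^ 2) :=
  ⟨hf.contDiff.norm_sq ℝ, fun x k hk => by rw [hf.periodic x k hk]⟩

lemma iteratedFDeriv (n : ℕ) (hf : SmoothPeriodic L f) :
    SmoothPeriodic L (iteratedFDeriv ℝ n f) := by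
  refine ⟨hf.contDiff.iteratedFDeriv_right (by exact_mod_cast le_top), fun x k hk => ?_⟩
  rw [← iteratedFDeriv_comp_add_right]
  congr 1
  funext y
  exact hf.periodic y k hk

lemma fderiv (hf : SmoothPeriodic L f) : SmoothPeriodic L (fderiv ℝ f) := by
  refine ⟨hf.contDiff.fderiv_right (by exact_mod_cast le_top), fun x k hk => ?_⟩
  rw [← fderiv_comp_add_right]
  congr 1
  funext y
  exact hf.periodic y k hk

lemma gradient {f : Ambient N d → ℝ} (hf : SmoothPeriodic L f) :
    SmoothPeriodic L (gradient f) :=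
  hf.fderiv.clm_comp
    -- The inverse Riesz map is conjugate-linear in general; over `ℝ` it is repackaged as a linear
    -- map.
    { toFun := (InnerProductSpace.toDual ℝ (Ambient N d)).symm
      map_add' := map_add _
      map_smul' := fun c v => by simp
      cont := (InnerProductSpace.toDual ℝ (Ambient N d)).symm.continuous }

/-- Taylor's formula, with a remainder that is uniform in the base point. -/
lemma taylor [Fact (0 < L)] [CompleteSpace G] (hf : SmoothPeriodic L f) (n : ℕ) :
    ∃ C, 0 ≤ C ∧ ∀ x y, ‖f (x + y) - ∑ k ∈ Finset.range (n + 1),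
      ((k.factorial : ℝ)⁻¹ • _root_.iteratedFDeriv ℝ k f x (fun _ => y))‖ ≤ C * ‖y‖ ^ (n + 1) := by
  obtain ⟨C, hC0, hC⟩ := (hf.iteratedFDeriv (n + 1)).bounded
  refine ⟨C, hC0, fun x y => ?_⟩
  rw [map_add_eq_sum_add_integral_iteratedFDeriv (f := f) (x := x) (y := y) (n := n)
    (fun t _ => (by exact_mod_cast (hf.contDiff_nat (n + 1)).contDiffAt)), add_sub_cancel_left,
    norm_smul]
  have h1 : ‖∫ t in (0 : ℝ)..1,
      (1 - t) ^ n • _root_.iteratedFDeriv ℝ (n + 1) f (x + t • y) (fun _ => y)‖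
      ≤ C * ‖y‖ ^ (n + 1) * |(1 : ℝ) - 0| := by
    refine intervalIntegral.norm_integral_le_of_norm_le_const fun t ht => ?_
    rw [Set.uIoc_of_le zero_le_one] at ht
    rw [norm_smul, norm_pow, Real.norm_eq_abs, abs_of_nonneg (by linarith [ht.2])]
    have h2 : (1 - t) ^ n ≤ 1 := pow_le_one₀ (by linarith [ht.2]) (by linarith [ht.1])
    have h3 : ‖_root_.iteratedFDeriv ℝ (n + 1) f (x + t • y) (fun _ => y)‖
        ≤ C * ‖y‖ ^ (n + 1) := by
      refine ((_root_.iteratedFDeriv ℝ (n + 1) f (x + t • y)).le_opNorm _).trans ?_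
      simpa using mul_le_mul_of_nonneg_right (hC (x + t • y)) (by positivity)
    calc _ ≤ 1 * (C * ‖y‖ ^ (n + 1)) := by gcongr
      _ = _ := one_mul _
  have h4 : ‖((n.factorial : ℝ))⁻¹‖ ≤ 1 := by
    rw [norm_inv, Real.norm_eq_abs, Nat.abs_cast]
    exact inv_le_one_of_one_le₀ (by exact_mod_cast Nat.factorial_pos n)
  calc _ ≤ 1 * (C * ‖y‖ ^ (n + 1)) := by
        refine mul_le_mul h4 (h1.trans (by simp)) (norm_nonneg _) zero_le_one
    _ = _ := one_mul _

end SmoothPeriodic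

lemma smoothPeriodic_lift {f : Torus L N d → ℝ} (hf : f ∈ smoothFunctions L N d) :
    SmoothPeriodic L (lift f) :=
  ⟨hf, fun x k hk => by simp only [lift, proj_add, hk, add_zero]⟩

/-- `rep` jumps across the faces of the box, but periodicity of `F` hides the jumps; this is how
smoothness descends to the torus. -/
lemma lift_comp_rep [Fact (0 < L)] {F : Ambient N d → ℝ} (hF : SmoothPeriodic L F) :
    lift (fun q : Torus L N d => F (rep q)) = F :=
  funext fun x => hF.apply_rep_proj x

lemma lift_apply_rep [Fact (0 < L)] (f : Torus L N d → ℝ) (q : Torus L N d) :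
    lift f (rep q) = f q := by
  rw [lift, proj_rep]

end Periodic

end MetropolizedEM

namespace MetropolizedEM

/-! ### Moments, symmetry and density of the standard Gaussian measure. -/

section Gaussian

variable {E : Type*} [NormedAddCommGroup E] [InnerProductSpace ℝ E] [FiniteDimensional ℝ E]
  [MeasurableSpace E] [BorelSpace E]
  {G : Type*} [NormedAddCommGroup G] [NormedSpace ℝ G]

lemma integrable_one_add_norm_pow (k : ℕ) :
    Integrable (fun g : E => (1 + ‖g‖) ^ k) (stdGaussian E) := by
  have h0 : MemLp (fun g : E => ‖g‖) k (stdGaussian E) :=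
    (IsGaussian.memLp_id (stdGaussian E) k (by simp)).norm
  have h : MemLp (fun g : E => 1 + ‖g‖) k (stdGaussian E) := (memLp_const (1 : ℝ)).add h0
  refine (h.integrable_norm_pow' ).congr (.of_forall fun g => ?_)
  simp only [Real.norm_eq_abs]
  rw [abs_of_nonneg (by positivity)]

lemma integrable_of_norm_le {f : E → G} (hf : AEStronglyMeasurable f (stdGaussian E)) {C : ℝ}
    {k : ℕ} (h : ∀ g, ‖f g‖ ≤ C * (1 + ‖g‖) ^ k) : Integrable f (stdGaussian E) :=
  ((integrable_one_add_norm_pow k).const_mul C).mono' hf (.of_forall h)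

/-- The moment `𝔼 (1 + |g|) ^ k` of a standard Gaussian vector. -/
noncomputable def absMoment (E : Type*) [NormedAddCommGroup E] [InnerProductSpace ℝ E] [FiniteDimensional ℝ E]
    [MeasurableSpace E] (k : ℕ) : ℝ := ∫ g : E, (1 + ‖g‖) ^ k ∂(stdGaussian E)

lemma absMoment_nonneg (k : ℕ) : 0 ≤ absMoment E k :=
  integral_nonneg fun g => by positivity

lemma norm_integral_le_absMoment {f : E → G} {C : ℝ} {k : ℕ}
    (h : ∀ g, ‖f g‖ ≤ C * (1 + ‖g‖) ^ k) :
    ‖∫ g, f g ∂(stdGaussian E)‖ ≤ C * absMoment E k := by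
  rw [absMoment, ← integral_const_mul]
  exact norm_integral_le_of_norm_le ((integrable_one_add_norm_pow k).const_mul C) (.of_forall h)

lemma integral_comp_neg_stdGaussian (f : E → G) :
    ∫ g, f (-g) ∂(stdGaussian E) = ∫ g, f g ∂(stdGaussian E) := by
  have h : MeasurePreserving (LinearIsometryEquiv.neg ℝ : E ≃ₗᵢ[ℝ] E)
      (stdGaussian E) (stdGaussian E) :=
    ⟨by fun_prop, stdGaussian_map _⟩
  exact h.integral_comp (LinearIsometryEquiv.neg ℝ : E ≃ₗᵢ[ℝ] E).toHomeomorph.measurableEmbedding f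

lemma integral_eq_zero_of_odd {f : E → ℝ} (hf : ∀ g, f (-g) = -f g) :
    ∫ g, f g ∂(stdGaussian E) = 0 := by
  have h := integral_comp_neg_stdGaussian f
  simp only [hf, integral_neg] at h
  linarith

lemma integral_multilinear_odd {k : ℕ} (hk : Odd k) (M : E [×k]→L[ℝ] ℝ) :
    ∫ g, M (fun _ => g) ∂(stdGaussian E) = 0 := by
  refine integral_eq_zero_of_odd fun g => ?_
  have := M.map_smul_univ (fun _ => (-1 : ℝ)) (fun _ => g)
  simpa [hk.neg_one_pow] using this

lemma norm_multilinear_diag_le {k : ℕ} (M : E [×k]→L[ℝ] ℝ) (g : E) :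
    ‖M (fun _ => g)‖ ≤ ‖M‖ * (1 + ‖g‖) ^ k := by
  refine (M.le_opNorm _).trans ?_
  simp only [Finset.prod_const, Finset.card_univ, Fintype.card_fin]
  gcongr
  linarith

lemma continuous_multilinear_diag {k : ℕ} (M : E [×k]→L[ℝ] ℝ) :
    Continuous fun g : E => M (fun _ => g) :=
  M.cont.comp (continuous_pi fun _ => continuous_id)

lemma integrable_multilinear_diag {k : ℕ} (M : E [×k]→L[ℝ] ℝ) :
    Integrable (fun g : E => M (fun _ => g)) (stdGaussian E) :=
  integrable_of_norm_le (continuous_multilinear_diag M).aestronglyMeasurable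
    (norm_multilinear_diag_le M)

lemma norm_multilinear_diag_smul_le {k : ℕ} (M : E [×k]→L[ℝ] ℝ) (g : E) :
    ‖M (fun _ => g) • g‖ ≤ ‖M‖ * (1 + ‖g‖) ^ (k + 1) := by
  rw [norm_smul, pow_succ, ← mul_assoc]
  gcongr
  · exact norm_multilinear_diag_le M g
  · linarith

lemma integrable_multilinear_diag_smul {k : ℕ} (M : E [×k]→L[ℝ] ℝ) :
    Integrable (fun g : E => M (fun _ => g) • g) (stdGaussian E) :=
  integrable_of_norm_le
    ((continuous_multilinear_diag M).smul continuous_id).aestronglyMeasurable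
    (norm_multilinear_diag_smul_le M)

/-- The map `M ↦ 𝔼 M(g, …, g)` on multilinear forms. -/
noncomputable def moment (E : Type*) [NormedAddCommGroup E] [InnerProductSpace ℝ E] [FiniteDimensional ℝ E]
    [MeasurableSpace E] [BorelSpace E] (k : ℕ) : (E [×k]→L[ℝ] ℝ) →L[ℝ] ℝ :=
  LinearMap.mkContinuous
    { toFun := fun M => ∫ g, M (fun _ => g) ∂(stdGaussian E)
      map_add' := fun M M' =>
        integral_add (integrable_multilinear_diag M) (integrable_multilinear_diag M')
      map_smul' := fun c M => integral_const_mul c _ }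
    (absMoment E k) fun M => by
      rw [mul_comm]
      exact norm_integral_le_absMoment (norm_multilinear_diag_le M)

lemma moment_apply {k : ℕ} (M : E [×k]→L[ℝ] ℝ) :
    moment E k M = ∫ g, M (fun _ => g) ∂(stdGaussian E) := rfl

/-- The map `M ↦ 𝔼 [M(g, …, g) g]` on multilinear forms. -/
noncomputable def vectorMoment (E : Type*) [NormedAddCommGroup E] [InnerProductSpace ℝ E]
    [FiniteDimensional ℝ E] [MeasurableSpace E] [BorelSpace E] (k : ℕ) :
    (E [×k]→L[ℝ] ℝ) →L[ℝ] E :=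
  LinearMap.mkContinuous
    { toFun := fun M => ∫ g, M (fun _ => g) • g ∂(stdGaussian E)
      map_add' := fun M M' => by
        simp only [add_apply, add_smul]
        exact integral_add (integrable_multilinear_diag_smul M)
          (integrable_multilinear_diag_smul M')
      map_smul' := fun c M => by
        simp only [smul_apply, smul_assoc, RingHom.id_apply]
        exact integral_smul c _ }
    (absMoment E (k + 1)) fun M => by
      rw [mul_comm]
      exact norm_integral_le_absMoment (norm_multilinear_diag_smul_le M)

lemma clm_vectorMoment {k : ℕ} (ℓ : E →L[ℝ] ℝ) (M : E [×k]→L[ℝ] ℝ) :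
    ℓ (vectorMoment E k M) = ∫ g, ℓ g * M (fun _ => g) ∂(stdGaussian E) := by
  change ℓ (∫ g, M (fun _ => g) • g ∂(stdGaussian E)) = _
  rw [← ℓ.integral_comp_comm (integrable_multilinear_diag_smul M)]
  simp [mul_comm]

lemma integral_inner_mul_inner (x y : E) :
    ∫ g, inner ℝ x g * inner ℝ y g ∂(stdGaussian E) = inner ℝ x y := by
  have h := covarianceBilin_apply (μ := stdGaussian E) IsGaussian.memLp_two_id x y
  rw [covarianceBilin_stdGaussian] at h
  rw [innerSL_apply_apply] at h
  simpa using h.symm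

/-- In an orthonormal basis `𝔼[gᵢ gⱼ] = δᵢⱼ`, so averaging the Hessian on the diagonal gives its
trace. The Laplacian thus appears directly in averaged Taylor expansions. -/
lemma laplacian_eq_moment (f : E → ℝ) (x : E) :
    Laplacian.laplacian f x = moment E 2 (iteratedFDeriv ℝ 2 f x) := by
  have e := stdOrthonormalBasis ℝ E
  have key : ∀ g : E, iteratedFDeriv ℝ 2 f x (fun _ => g) =
      ∑ i, ∑ j, inner ℝ (e i) g * inner ℝ (e j) g * iteratedFDeriv ℝ 2 f x ![e i, e j] := by
    intro g
    simp only [iteratedFDeriv_two_apply, Matrix.cons_val_zero, Matrix.cons_val_one]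
    conv_lhs => rw [← e.sum_repr' g]
    simp only [map_sum, map_smul, sum_apply, smul_apply,
      smul_eq_mul, Finset.mul_sum]
    rw [Finset.sum_comm]
    refine Finset.sum_congr rfl fun i _ => Finset.sum_congr rfl fun j _ => ?_
    ring
  have hint : ∀ x y : E, Integrable (fun g => inner ℝ x g * inner ℝ y g) (stdGaussian E) := by
    intro x y
    refine integrable_of_norm_le (C := ‖x‖ * ‖y‖) (k := 2)
      (Continuous.aestronglyMeasurable (by fun_prop)) fun g => ?_
    rw [norm_mul]
    calc _ ≤ (‖x‖ * ‖g‖) * (‖y‖ * ‖g‖) := by gcongr <;> exact norm_inner_le_norm _ _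
      _ = ‖x‖ * ‖y‖ * ‖g‖ ^ 2 := by ring
      _ ≤ _ := by gcongr; linarith
  rw [InnerProductSpace.laplacian_eq_iteratedFDeriv_orthonormalBasis f e, moment_apply]
  simp_rw [key]
  rw [integral_finsetSum _ fun i _ => integrable_finsetSum _ fun j _ => (hint _ _).mul_const _]
  refine Finset.sum_congr rfl fun i _ => ?_
  rw [integral_finsetSum _ fun j _ => (hint _ _).mul_const _]
  simp_rw [integral_mul_const, integral_inner_mul_inner, e.inner_eq_ite]
  simp

/-- Both measures have the same characteristic function. The value of `c` is irrelevant later: only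
its independence of the position matters for detailed balance. -/
lemma stdGaussian_eq_withDensity : ∃ c : ℝ, 0 < c ∧
    stdGaussian E = volume.withDensity
      (fun x : E => ENNReal.ofReal (c * Real.exp (-(1 / 2) * ‖x‖ ^ 2))) := by
  set K : ℝ := (Real.pi / (1 / 2)) ^ (Module.finrank ℝ E / 2 : ℝ) with hK
  have hKpos : 0 < K := by positivity
  have hint : Integrable (fun x : E => K⁻¹ * Real.exp (-(1 / 2) * ‖x‖ ^ 2)) := by
    refine Integrable.const_mul ?_ _
    have := GaussianFourier.integrable_cexp_neg_mul_sq_norm_add (V := E) (b := ((1 / 2 : ℝ) : ℂ)) (by simp) 0 0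
    refine this.norm.congr (.of_forall fun x => ?_)
    simp [Complex.norm_exp, ← Complex.ofReal_pow]
  refine ⟨K⁻¹, by positivity, ?_⟩
  -- Finite mass is needed for the characteristic function to determine the measure.
  have := isFiniteMeasure_withDensity_ofReal hint.2
  refine Measure.ext_of_charFun (funext fun t => ?_)
  rw [charFun_stdGaussian, charFun_apply, integral_withDensity_eq_integral_toReal_smul
    (by fun_prop) (by simp)]
  have h1 : ∀ x : E, (ENNReal.ofReal (K⁻¹ * Real.exp (-(1 / 2) * ‖x‖ ^ 2))).toReal •
      Complex.exp (inner ℝ x t * Complex.I) = (K : ℂ)⁻¹ *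
        Complex.exp (-((1 / 2 : ℝ) : ℂ) * ‖x‖ ^ 2 + Complex.I * inner ℝ t x) := by
    intro x
    rw [ENNReal.toReal_ofReal (by positivity), Complex.exp_add, real_inner_comm x t,
      Complex.real_smul]
    push_cast
    rw [mul_comm Complex.I]
    ring
  simp_rw [h1]
  rw [integral_const_mul, GaussianFourier.integral_cexp_neg_mul_sq_norm_add (by simp)]
  have h2 : ((Real.pi : ℂ) / ((1 / 2 : ℝ) : ℂ)) ^ ((Module.finrank ℝ E : ℂ) / 2) = (K : ℂ) := by
    rw [hK, Complex.ofReal_cpow (by positivity)]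
    push_cast
    rfl
  rw [h2, ← mul_assoc, inv_mul_cancel₀ (by exact_mod_cast hKpos.ne'), one_mul, Complex.I_sq]
  congr 1
  push_cast
  ring

lemma integrable_exp_neg_mul_norm_sq {b : ℝ} (hb : 0 < b) :
    Integrable (fun x : E => Real.exp (-b * ‖x‖ ^ 2)) := by
  have := GaussianFourier.integrable_cexp_neg_mul_sq_norm_add (V := E) (b := (b : ℂ)) (by simpa) 0 0
  refine this.norm.congr (.of_forall fun x => ?_)
  simp [Complex.norm_exp, ← Complex.ofReal_pow]

/-- The expectation of a function of a non-degenerate isotropic Gaussian vector, as an integral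
against the Lebesgue measure. -/
lemma integral_affine_stdGaussian {σ : ℝ} (hσ : 0 < σ) : ∃ c : ℝ, ∀ (f : E → ℝ) (a : E),
    ∫ g, f (a + σ • g) ∂(stdGaussian E) =
      ∫ h, f h * (c * Real.exp (-(‖h - a‖ ^ 2 / (2 * σ ^ 2)))) := by
  obtain ⟨c, hc, h⟩ := stdGaussian_eq_withDensity (E := E)
  refine ⟨|(σ ^ Module.finrank ℝ E)⁻¹| * c, fun f a => ?_⟩
  rw [h, integral_withDensity_eq_integral_toReal_smul (by fun_prop) (by simp)]
  set F : E → ℝ := fun h => f (a + h) * (c * Real.exp (-(‖h‖ ^ 2 / (2 * σ ^ 2)))) with hF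
  have h1 : ∀ g : E, (ENNReal.ofReal (c * Real.exp (-(1 / 2) * ‖g‖ ^ 2))).toReal •
      f (a + σ • g) = F (σ • g) := by
    intro g
    rw [ENNReal.toReal_ofReal (by positivity), hF, smul_eq_mul, mul_comm]
    simp only [norm_smul, Real.norm_eq_abs, mul_pow, sq_abs]
    congr 3
    field_simp
  simp_rw [h1]
  rw [Measure.integral_comp_smul, smul_eq_mul, ← integral_const_mul,
    ← integral_sub_right_eq_self _ a]
  congr 1
  funext x
  simp only [hF, add_sub_cancel]
  ring

end Gaussian

end MetropolizedEM

namespace MetropolizedEM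

/-! ### Pointwise expansion of the acceptance probability. -/

section Acceptance

variable {L : ℝ} {N d : ℕ}

/-- The logarithm of the Metropolis ratio of the move from `x` to `x + y`. -/
noncomputable def logRatio (β : ℝ) (W : Ambient N d → ℝ) (dt : ℝ) (x y : Ambient N d) : ℝ :=
  -β * (W (x + y) - W x - (fderiv ℝ W x y + fderiv ℝ W (x + y) y) / 2)
    - β ^ 2 * dt / 4 * (‖gradient W (x + y)‖ ^ 2 - ‖gradient W x‖ ^ 2)

lemma inner_gradient (W : Ambient N d → ℝ) (x y : Ambient N d) :
    inner ℝ y (gradient W x) = fderiv ℝ W x y := by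
  rw [real_inner_comm, gradient, InnerProductSpace.toDual_symm_apply]

/-- The normalizations and the terms `‖y‖²` cancel between the forward and backward Gaussians. The
cross terms supply exactly the endpoint average of `∇W · y` that the trapezoidal rule subtracts from
`W(x + y) - W(x)`. -/
lemma acceptance_eq (β : ℝ) (V : Torus L N d → ℝ) {dt : ℝ} (hdt : 0 < dt) (x y : Ambient N d) :
    acceptance β V dt x (x + y) = min (Real.exp (logRatio β (lift V) dt x y)) 1 := by
  unfold acceptance transitionDensity
  congr 1
  set W := lift V
  have hc : (1 / (4 * Real.pi * dt)) ^ (((d * N : ℕ) : ℝ) / 2) ≠ 0 := by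
    have : 0 < 1 / (4 * Real.pi * dt) := by positivity
    positivity
  rw [mul_left_comm, mul_left_comm (Real.exp (-β * W x)), mul_div_mul_left _ _ hc,
    ← Real.exp_add, ← Real.exp_add, ← Real.exp_sub]
  congr 1
  have e1 : x - (x + y) + (β * dt) • gradient W (x + y)
      = -(y - (β * dt) • gradient W (x + y)) := by abel
  have e2 : x + y - x + (β * dt) • gradient W x = y + (β * dt) • gradient W x := by abel
  rw [e1, e2, norm_neg, norm_sub_sq_real, norm_add_sq_real, inner_smul_right, inner_smul_right,
    inner_gradient, inner_gradient, norm_smul, norm_smul, mul_pow, mul_pow, Real.norm_eq_abs,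
    sq_abs, logRatio]
  field_simp
  ring

/-- The proposed increment of the scheme with time step `s ^ 2`. -/
noncomputable def proposal (β : ℝ) (W : Ambient N d → ℝ) (s : ℝ) (x g : Ambient N d) :
    Ambient N d :=
  -((β * s ^ 2) • gradient W x) + (√2 * s) • g

/-- The leading coefficient of the logarithm of the Metropolis ratio. -/
noncomputable def leadingTerm (β : ℝ) (W : Ambient N d → ℝ) (x g : Ambient N d) : ℝ :=
  β / 12 * √2 ^ 3 * iteratedFDeriv ℝ 3 W x (fun _ => g)
    - β ^ 2 / 4 * √2 * iteratedFDeriv ℝ 1 (fun x => ‖gradient W x‖ ^ 2) x (fun _ => g)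

/-- Only forms of degrees 3 and 1 in `g` occur. This oddness later removes `|leadingTerm|` from the
averaged correction. -/
lemma leadingTerm_neg (β : ℝ) (W : Ambient N d → ℝ) (x g : Ambient N d) :
    leadingTerm β W x (-g) = -leadingTerm β W x g := by
  have h3 := (iteratedFDeriv ℝ 3 W x).map_smul_univ (fun _ => (-1 : ℝ)) (fun _ => g)
  have h1 := (iteratedFDeriv ℝ 1 (fun x => ‖gradient W x‖ ^ 2) x).map_smul_univ
    (fun _ => (-1 : ℝ)) (fun _ => g)
  simp only [neg_smul, one_smul, Finset.prod_const, Finset.card_univ, Fintype.card_fin] at h1 h3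
  rw [leadingTerm, leadingTerm, h1, h3]
  simp only [smul_eq_mul]
  ring

namespace SmoothPeriodic

variable [Fact (0 < L)] {W : Ambient N d → ℝ}

lemma norm_iteratedFDeriv_diag_le (hW : SmoothPeriodic L W) (k : ℕ) :
    ∃ C, 0 ≤ C ∧ ∀ x y, ‖_root_.iteratedFDeriv ℝ k W x (fun _ => y)‖ ≤ C * ‖y‖ ^ k := by
  obtain ⟨C, hC0, hC⟩ := (hW.iteratedFDeriv k).bounded
  refine ⟨C, hC0, fun x y => ((_root_.iteratedFDeriv ℝ k W x).le_opNorm _).trans ?_⟩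
  simpa using mul_le_mul_of_nonneg_right (hC x) (by positivity)

lemma norm_iteratedFDeriv_diag_sub_le (hW : SmoothPeriodic L W) (k : ℕ) :
    ∃ C, 0 ≤ C ∧ ∀ (x y z : Ambient N d) (R : ℝ), ‖y‖ ≤ R → ‖z‖ ≤ R →
      |_root_.iteratedFDeriv ℝ k W x (fun _ => y) - _root_.iteratedFDeriv ℝ k W x (fun _ => z)|
        ≤ C * R ^ (k - 1) * ‖y - z‖ := by
  obtain ⟨C, hC0, hC⟩ := (hW.iteratedFDeriv k).bounded
  refine ⟨C * k, by positivity, fun x y z R hy hz => ?_⟩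
  have hR : 0 ≤ R := (norm_nonneg y).trans hy
  -- The telescoping estimate for a `k`-linear form yields the factor `k` and the power `k - 1`; for
  -- `k = 0` the factor makes the bound zero.
  have h := (_root_.iteratedFDeriv ℝ k W x).norm_image_sub_le (fun _ => y) (fun _ => z)
  rw [Fintype.card_fin, Real.norm_eq_abs] at h
  have h1 : ‖fun _ : Fin k => y‖ ≤ R := (pi_norm_le_iff_of_nonneg hR).2 fun _ => hy
  have h2 : ‖fun _ : Fin k => z‖ ≤ R := (pi_norm_le_iff_of_nonneg hR).2 fun _ => hz
  have h3 : ‖(fun _ : Fin k => y) - (fun _ => z)‖ ≤ ‖y - z‖ :=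
    (pi_norm_le_iff_of_nonneg (norm_nonneg _)).2 fun _ => le_rfl
  refine h.trans ?_
  have := hC x
  have h4 : max ‖fun _ : Fin k => y‖ ‖fun _ : Fin k => z‖ ≤ R := max_le h1 h2
  gcongr

/-- The error of the trapezoidal rule along a segment. -/
lemma trapezoid (hW : SmoothPeriodic L W) :
    ∃ C, 0 ≤ C ∧ ∀ x y : Ambient N d,
      |W (x + y) - W x - (_root_.fderiv ℝ W x y + _root_.fderiv ℝ W (x + y) y) / 2
        + _root_.iteratedFDeriv ℝ 3 W x (fun _ => y) / 12| ≤ C * ‖y‖ ^ 4 := by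
  -- With `W` expanded to order 3 and `DW` to order 2, orders 1 and 2 cancel and order 3 leaves `1/6
  -- - 1/4 = -1/12`. The remainder of `DW` is paired with `y` and halved, hence `C' / 2`.
  obtain ⟨C, hC0, hC⟩ := hW.taylor 3
  obtain ⟨C', hC0', hC'⟩ := hW.fderiv.taylor 2
  refine ⟨C + C' / 2, by positivity, fun x y => ?_⟩
  have h1 := hC x y
  have h2 := (ContinuousLinearMap.le_opNorm _ y).trans
    (mul_le_mul_of_nonneg_right (hC' x y) (norm_nonneg y))
  have h3 : ∀ k, _root_.iteratedFDeriv ℝ k (_root_.fderiv ℝ W) x (fun _ => y) y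
      = _root_.iteratedFDeriv ℝ (k + 1) W x (fun _ => y) := by
    intro k
    rw [iteratedFDeriv_succ_apply_right]
    rfl
  simp only [Finset.sum_range_succ, Finset.sum_range_zero, sub_apply, add_apply, smul_apply, h3,
    Real.norm_eq_abs, smul_eq_mul, Nat.factorial, zero_add] at h1 h2
  rw [iteratedFDeriv_zero_apply, iteratedFDeriv_one_apply] at h1
  rw [iteratedFDeriv_one_apply] at h2
  push_cast at h1 h2
  rw [abs_le] at h1 h2 ⊢
  constructor <;> nlinarith [h1.1, h1.2, h2.1, h2.2]

/-- The drift has size `s²` and the noise size `s`: the increment may be replaced by its noise at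
the cost of one extra power of `s`. -/
lemma norm_proposal_le (hW : SmoothPeriodic L W) (β : ℝ) :
    ∃ K, 0 ≤ K ∧ ∀ (s : ℝ) (x g : Ambient N d), 0 ≤ s → s ≤ 1 →
      ‖proposal β W s x g‖ ≤ K * s * (1 + ‖g‖) ∧ ‖(√2 * s) • g‖ ≤ K * s * (1 + ‖g‖) ∧
      ‖proposal β W s x g - (√2 * s) • g‖ ≤ K * s ^ 2 := by
  obtain ⟨C, hC0, hC⟩ := hW.gradient.bounded
  refine ⟨|β| * C + √2, by positivity, fun s x g hs hs1 => ?_⟩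
  have hg := norm_nonneg g
  have h1 : ‖(√2 * s) • g‖ = √2 * s * ‖g‖ := by
    rw [norm_smul, Real.norm_eq_abs, abs_of_nonneg (by positivity)]
  have h2 : ‖(β * s ^ 2) • _root_.gradient W x‖ ≤ |β| * C * s ^ 2 := by
    rw [norm_smul, Real.norm_eq_abs, abs_mul, abs_of_nonneg (sq_nonneg s)]
    nlinarith [mul_le_mul_of_nonneg_left (hC x) (mul_nonneg (abs_nonneg β) (sq_nonneg s))]
  have h3 : 0 ≤ |β| * C := by positivity
  have h4 : 0 ≤ √2 * s := by positivity
  have h5 : |β| * C * s ^ 2 ≤ |β| * C * s := by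
    have : s ^ 2 ≤ s := by nlinarith
    gcongr
  have h6 : 0 ≤ |β| * C * s := by positivity
  refine ⟨?_, ?_, ?_⟩
  · refine (norm_add_le _ _).trans ?_
    rw [norm_neg, h1]
    nlinarith [mul_nonneg h6 hg]
  · rw [h1]
    nlinarith [mul_nonneg h6 hg]
  · rw [proposal, add_sub_cancel_right, norm_neg]
    nlinarith [mul_nonneg (Real.sqrt_nonneg 2) (sq_nonneg s)]

lemma leadingTerm_bound (hW : SmoothPeriodic L W) (β : ℝ) :
    ∃ C, 0 ≤ C ∧ ∀ x g, |leadingTerm β W x g| ≤ C * (1 + ‖g‖) ^ 3 := by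
  obtain ⟨C3, hC30, hC3⟩ := hW.norm_iteratedFDeriv_diag_le 3
  obtain ⟨C1, hC10, hC1⟩ := hW.gradient.norm_sq.norm_iteratedFDeriv_diag_le 1
  refine ⟨|β / 12 * √2 ^ 3| * C3 + |β ^ 2 / 4 * √2| * C1, by positivity, fun x g => ?_⟩
  have hg := norm_nonneg g
  refine (abs_sub _ _).trans ?_
  rw [abs_mul, abs_mul (β ^ 2 / 4 * √2), add_mul, mul_assoc _ C3, mul_assoc _ C1]
  have h3 := hC3 x g
  have h1 := hC1 x g
  rw [Real.norm_eq_abs] at h1 h3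
  gcongr
  · refine h3.trans ?_
    gcongr
    linarith
  · refine h1.trans ?_
    gcongr
    calc ‖g‖ ^ 1 ≤ (1 + ‖g‖) ^ 1 := by gcongr; linarith
      _ ≤ (1 + ‖g‖) ^ 3 := pow_le_pow_right₀ (by linarith) (by norm_num)

/-- There are four errors of order `s⁴`: the trapezoidal remainder, the Taylor remainder of `|∇W|²`,
and the replacement of the increment by its noise in the cubic and in the linear form. They are the
four summands of the constant. -/
lemma logRatio_expansion (hW : SmoothPeriodic L W) (β : ℝ) :
    ∃ C, 0 ≤ C ∧ ∀ (s : ℝ) (x g : Ambient N d), 0 ≤ s → s ≤ 1 →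
      |logRatio β W (s ^ 2) x (proposal β W s x g) - s ^ 3 * leadingTerm β W x g|
        ≤ C * s ^ 4 * (1 + ‖g‖) ^ 4 := by
  obtain ⟨K, hK0, hK⟩ := hW.norm_proposal_le β
  obtain ⟨C1, hC10, hC1⟩ := hW.trapezoid
  obtain ⟨C2, hC20, hC2⟩ := hW.gradient.norm_sq.taylor 1
  obtain ⟨C3, hC30, hC3⟩ := hW.norm_iteratedFDeriv_diag_sub_le 3
  obtain ⟨C4, hC40, hC4⟩ := hW.gradient.norm_sq.norm_iteratedFDeriv_diag_sub_le 1
  refine ⟨|β| * (C1 * K ^ 4) + |β / 12| * (C3 * K ^ 2 * K) + β ^ 2 / 4 * (C2 * K ^ 2)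
    + β ^ 2 / 4 * (C4 * K), by positivity, fun s x g hs hs1 => ?_⟩
  obtain ⟨k1, k2, k3⟩ := hK s x g hs hs1
  set y := proposal β W s x g
  set z := (√2 * s) • g with hz
  set F : Ambient N d → ℝ := fun x => ‖_root_.gradient W x‖ ^ 2 with hF
  set G := 1 + ‖g‖ with hG
  have hG1 : 1 ≤ G := by rw [hG]; linarith [norm_nonneg g]
  have hG0 : 0 ≤ G := by linarith
  have t1 := hC1 x y
  have t2 := hC2 x y
  have t3 := hC3 x y z _ k1 k2
  have t4 := hC4 x y z _ k1 k2
  simp only [Finset.sum_range_succ, Finset.sum_range_zero, Real.norm_eq_abs, smul_eq_mul,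
    Nat.factorial, zero_add, iteratedFDeriv_zero_apply] at t2
  have h3 := (_root_.iteratedFDeriv ℝ 3 W x).map_smul_univ (fun _ => √2 * s) (fun _ => g)
  have h1 := (_root_.iteratedFDeriv ℝ 1 F x).map_smul_univ (fun _ => √2 * s) (fun _ => g)
  simp only [Finset.prod_const, Finset.card_univ, Fintype.card_fin, ← hz, smul_eq_mul] at h1 h3
  have hG2 : G ^ 2 ≤ G ^ 4 := pow_le_pow_right₀ hG1 (by norm_num)
  have hG3 : 1 ≤ G ^ 4 := one_le_pow₀ hG1
  have b1 : |W (x + y) - W x - (_root_.fderiv ℝ W x y + _root_.fderiv ℝ W (x + y) y) / 2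
        + _root_.iteratedFDeriv ℝ 3 W x (fun _ => y) / 12| ≤ C1 * K ^ 4 * (s ^ 4 * G ^ 4) := by
    refine t1.trans ?_
    calc C1 * ‖y‖ ^ 4 ≤ C1 * (K * s * G) ^ 4 := by gcongr
      _ = _ := by ring
  have b2 : s ^ 2 * |F (x + y) - F x - _root_.iteratedFDeriv ℝ 1 F x (fun _ => y)|
      ≤ C2 * K ^ 2 * (s ^ 4 * G ^ 4) := by
    have e : F (x + y) - F x - _root_.iteratedFDeriv ℝ 1 F x (fun _ => y)
        = F (x + y) - (((1 : ℕ) : ℝ)⁻¹ * F x + (((0 + 1) * 1 : ℕ) : ℝ)⁻¹ *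
          _root_.iteratedFDeriv ℝ 1 F x (fun _ => y)) := by
      push_cast; ring
    rw [e]
    calc _ ≤ s ^ 2 * (C2 * (K * s * G) ^ 2) := by
          gcongr
          refine t2.trans ?_
          gcongr
      _ = C2 * K ^ 2 * (s ^ 4 * G ^ 2) := by ring
      _ ≤ _ := by gcongr
  have b3 : |_root_.iteratedFDeriv ℝ 3 W x (fun _ => y) - _root_.iteratedFDeriv ℝ 3 W x (fun _ => z)|
      ≤ C3 * K ^ 2 * K * (s ^ 4 * G ^ 4) := by
    calc _ ≤ C3 * (K * s * G) ^ 2 * ‖y - z‖ := t3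
      _ ≤ C3 * (K * s * G) ^ 2 * (K * s ^ 2) := by gcongr
      _ = C3 * K ^ 2 * K * (s ^ 4 * G ^ 2) := by ring
      _ ≤ _ := by gcongr
  have b4 : s ^ 2 * |_root_.iteratedFDeriv ℝ 1 F x (fun _ => y)
      - _root_.iteratedFDeriv ℝ 1 F x (fun _ => z)| ≤ C4 * K * (s ^ 4 * G ^ 4) := by
    calc _ ≤ s ^ 2 * (C4 * (K * s * G) ^ 0 * ‖y - z‖) := by gcongr
      _ ≤ s ^ 2 * (C4 * (K * s * G) ^ 0 * (K * s ^ 2)) := by gcongr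
      _ = C4 * K * (s ^ 4 * 1) := by ring
      _ ≤ _ := by gcongr
  have e : logRatio β W (s ^ 2) x y - s ^ 3 * leadingTerm β W x g =
      -β * (W (x + y) - W x - (_root_.fderiv ℝ W x y + _root_.fderiv ℝ W (x + y) y) / 2
        + _root_.iteratedFDeriv ℝ 3 W x (fun _ => y) / 12)
      + β / 12 * (_root_.iteratedFDeriv ℝ 3 W x (fun _ => y)
        - _root_.iteratedFDeriv ℝ 3 W x (fun _ => z))
      - β ^ 2 / 4 * (s ^ 2 * (F (x + y) - F x - _root_.iteratedFDeriv ℝ 1 F x (fun _ => y)))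
      - β ^ 2 / 4 * (s ^ 2 * (_root_.iteratedFDeriv ℝ 1 F x (fun _ => y)
        - _root_.iteratedFDeriv ℝ 1 F x (fun _ => z))) := by
    rw [logRatio, leadingTerm, h1, h3]
    simp only [hF]
    ring
  rw [e]
  refine ((abs_sub _ _).trans (add_le_add_left ((abs_sub _ _).trans
    (add_le_add_left (abs_add_le _ _) _)) _)).trans ?_
  rw [abs_mul, abs_mul (β / 12), abs_mul (β ^ 2 / 4), abs_mul (β ^ 2 / 4), abs_mul (s ^ 2),
    abs_mul (s ^ 2), abs_neg, abs_of_nonneg (sq_nonneg s),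
    abs_of_nonneg (by positivity : 0 ≤ β ^ 2 / 4), mul_assoc _ (s ^ 4), add_mul, add_mul, add_mul,
    mul_assoc |β|, mul_assoc |β / 12|, mul_assoc (β ^ 2 / 4), mul_assoc (β ^ 2 / 4)]
  gcongr

end SmoothPeriodic

/-- The map `t ↦ max (-t) 0` is 1-Lipschitz, which allows `a` to be replaced by `z` despite the
kink. At `a` itself the error is zero for `a ≥ 0`, second order for `-1 ≤ a ≤ 0`, and at most `-a ≤
a²` below `-1`. -/
lemma abs_min_exp_sub_le (a z : ℝ) :
    |min (Real.exp a) 1 - 1 + max (-z) 0| ≤ |a - z| + a ^ 2 := by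
  have h1 : |max (-a) 0 - max (-z) 0| ≤ |a - z| := by
    refine (abs_max_sub_max_le_abs (-a) (-z) 0).trans ?_
    rw [← abs_neg]
    apply le_of_eq
    congr 1
    ring
  have h2 : |min (Real.exp a) 1 - 1 + max (-a) 0| ≤ a ^ 2 := by
    rcases le_total 0 a with ha | ha
    · rw [min_eq_right (Real.one_le_exp ha), max_eq_right (by linarith)]
      simp only [sub_self, add_zero, abs_zero]
      positivity
    · rw [min_eq_left (Real.exp_le_one_iff.2 ha), max_eq_left (by linarith)]
      rcases le_total (-1) a with h | h
      · have := Real.abs_exp_sub_one_sub_id_le (x := a) (by rw [abs_le]; constructor <;> linarith)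
        rwa [← sub_eq_add_neg]
      · rw [abs_le]
        have := Real.exp_pos a
        have := Real.exp_le_one_iff.2 ha
        constructor <;> nlinarith
  calc _ = |(min (Real.exp a) 1 - 1 + max (-a) 0) - (max (-a) 0 - max (-z) 0)| := by
        congr 1; ring
    _ ≤ _ := (abs_sub _ _).trans (by linarith)

/-- The leading coefficient of the rejection probability. -/
noncomputable def rejectionCoeff (β : ℝ) (W : Ambient N d → ℝ) (x g : Ambient N d) : ℝ :=
  max (-leadingTerm β W x g) 0

lemma SmoothPeriodic.acceptance_expansion [Fact (0 < L)] {W : Ambient N d → ℝ}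
    (hW : SmoothPeriodic L W) (β : ℝ) :
    ∃ C, 0 ≤ C ∧ ∀ (s : ℝ) (x g : Ambient N d), 0 ≤ s → s ≤ 1 →
      |min (Real.exp (logRatio β W (s ^ 2) x (proposal β W s x g))) 1 - 1
        + s ^ 3 * rejectionCoeff β W x g| ≤ C * s ^ 4 * (1 + ‖g‖) ^ 8 := by
  obtain ⟨C, hC0, hC⟩ := hW.logRatio_expansion β
  obtain ⟨D, hD0, hD⟩ := hW.leadingTerm_bound β
  refine ⟨C + (C + D) ^ 2, by positivity, fun s x g hs hs1 => ?_⟩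
  have h1 := hC s x g hs hs1
  have h2 := hD x g
  set a := logRatio β W (s ^ 2) x (proposal β W s x g)
  set z := leadingTerm β W x g
  have e : s ^ 3 * rejectionCoeff β W x g = max (-(s ^ 3 * z)) 0 := by
    rw [rejectionCoeff, ← mul_neg, mul_max_of_nonneg _ _ (by positivity), mul_zero]
  rw [e]
  set G := 1 + ‖g‖ with hG
  have hG1 : 1 ≤ G := by rw [hG]; linarith [norm_nonneg g]
  have hG0 : 0 ≤ G := by linarith
  have hG2 : G ^ 4 ≤ G ^ 8 := pow_le_pow_right₀ hG1 (by norm_num)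
  -- The true order is `s³`; `s²` suffices, since its square matches the error `s⁴` already present.
  -- Squaring also doubles the growth to `G⁸`.
  have h3 : |a| ≤ (C + D) * s ^ 2 * G ^ 4 := by
    have : |a| ≤ |a - s ^ 3 * z| + |s ^ 3 * z| := by
      have := abs_add_le (a - s ^ 3 * z) (s ^ 3 * z)
      rwa [sub_add_cancel] at this
    rw [abs_mul, abs_of_nonneg (by positivity : 0 ≤ s ^ 3)] at this
    refine this.trans ?_
    have h5 : s ^ 3 * |z| ≤ D * s ^ 2 * G ^ 4 := by
      calc s ^ 3 * |z| ≤ s ^ 2 * (D * G ^ 4) := by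
            refine mul_le_mul ?_ (h2.trans ?_) (abs_nonneg _) (by positivity)
            · exact pow_le_pow_of_le_one hs hs1 (by norm_num)
            · have := pow_le_pow_right₀ hG1 (show 3 ≤ 4 by norm_num)
              gcongr
        _ = _ := by ring
    have h6 : C * s ^ 4 * G ^ 4 ≤ C * s ^ 2 * G ^ 4 := by
      have := pow_le_pow_of_le_one hs hs1 (show 2 ≤ 4 by norm_num)
      gcongr
    linarith
  have h4 : a ^ 2 ≤ (C + D) ^ 2 * s ^ 4 * G ^ 8 := by
    rw [← sq_abs]
    calc |a| ^ 2 ≤ ((C + D) * s ^ 2 * G ^ 4) ^ 2 := by gcongr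
      _ = _ := by ring
  calc _ ≤ |a - s ^ 3 * z| + a ^ 2 := abs_min_exp_sub_le _ _
    _ ≤ C * s ^ 4 * G ^ 8 + (C + D) ^ 2 * s ^ 4 * G ^ 8 := by
        refine add_le_add (h1.trans ?_) h4
        gcongr
    _ = _ := by ring

end Acceptance

end MetropolizedEM

namespace MetropolizedEM

/-! ### Moments of the acceptance probability, uniformly on the torus. -/

section Rejection

variable {L : ℝ} {N d : ℕ}

namespace SmoothPeriodic

variable {W : Ambient N d → ℝ}

lemma continuous_iteratedFDeriv_diag (hW : SmoothPeriodic L W) (k : ℕ) :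
    Continuous fun p : Ambient N d × Ambient N d =>
      _root_.iteratedFDeriv ℝ k W p.1 (fun _ => p.2) := by
  have h := (hW.iteratedFDeriv k).continuous
  fun_prop

lemma continuous_leadingTerm (hW : SmoothPeriodic L W) (β : ℝ) :
    Continuous fun p : Ambient N d × Ambient N d => leadingTerm β W p.1 p.2 := by
  unfold leadingTerm
  exact (continuous_const.mul (hW.continuous_iteratedFDeriv_diag 3)).sub
    (continuous_const.mul (hW.gradient.norm_sq.continuous_iteratedFDeriv_diag 1))

lemma continuous_rejectionCoeff (hW : SmoothPeriodic L W) (β : ℝ) :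
    Continuous fun p : Ambient N d × Ambient N d => rejectionCoeff β W p.1 p.2 :=
  (hW.continuous_leadingTerm β).neg.max continuous_const

lemma rejectionCoeff_bound [Fact (0 < L)] (hW : SmoothPeriodic L W) (β : ℝ) :
    ∃ C, 0 ≤ C ∧ ∀ x g, |rejectionCoeff β W x g| ≤ C * (1 + ‖g‖) ^ 3 := by
  obtain ⟨C, hC0, hC⟩ := hW.leadingTerm_bound β
  refine ⟨C, hC0, fun x g => le_trans ?_ (hC x g)⟩
  rw [rejectionCoeff, abs_of_nonneg (le_max_right _ _)]
  exact max_le (neg_le_abs _) (abs_nonneg _)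

lemma continuous_logRatio (hW : SmoothPeriodic L W) (β dt : ℝ) :
    Continuous fun p : Ambient N d × Ambient N d => logRatio β W dt p.1 p.2 := by
  unfold logRatio
  have h1 := hW.continuous
  have h2 := hW.fderiv.continuous
  have h3 := hW.gradient.continuous
  fun_prop

lemma continuous_proposal (hW : SmoothPeriodic L W) (β s : ℝ) :
    Continuous fun p : Ambient N d × Ambient N d => proposal β W s p.1 p.2 := by
  unfold proposal
  have h3 := hW.gradient.continuous
  fun_prop

end SmoothPeriodic

variable [Fact (0 < L)] {V : Torus L N d → ℝ}

lemma increment_eq_proposal (β : ℝ) (V : Torus L N d → ℝ) {dt : ℝ} (hdt : 0 ≤ dt)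
    (q : Torus L N d) (g : Ambient N d) :
    increment β V dt q g = proposal β (lift V) √dt (rep q) g := by
  rw [increment, proposal, Real.sq_sqrt hdt, Real.sqrt_mul zero_le_two]
  rfl

lemma proposalAcceptance_eq (β : ℝ) (V : Torus L N d → ℝ) {dt : ℝ} (hdt : 0 < dt)
    (q : Torus L N d) (g : Ambient N d) :
    proposalAcceptance β V dt q g =
      min (Real.exp (logRatio β (lift V) dt (rep q) (proposal β (lift V) √dt (rep q) g))) 1 := by
  rw [proposalAcceptance, acceptance_eq β V hdt, increment_eq_proposal β V hdt.le]

lemma measurable_proposalAcceptance (hV : SmoothPeriodic L (lift V)) (β : ℝ) {dt : ℝ}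
    (hdt : 0 < dt) :
    Measurable fun p : Torus L N d × Ambient N d => proposalAcceptance β V dt p.1 p.2 := by
  simp_rw [proposalAcceptance_eq β V hdt]
  have h1 := (hV.continuous_logRatio β dt).measurable
  have h2 := (hV.continuous_proposal β √dt).measurable
  have h3 : Measurable fun p : Torus L N d × Ambient N d => (rep p.1 : Ambient N d) :=
    measurable_rep.comp measurable_fst
  exact (Real.measurable_exp.comp (h1.comp (h3.prodMk (h2.comp (h3.prodMk measurable_snd))))).min
    measurable_const

lemma proposalAcceptance_mem (β : ℝ) (V : Torus L N d → ℝ) {dt : ℝ} (hdt : 0 < dt)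
    (q : Torus L N d) (g : Ambient N d) :
    0 ≤ proposalAcceptance β V dt q g ∧ proposalAcceptance β V dt q g ≤ 1 := by
  rw [proposalAcceptance_eq β V hdt]
  exact ⟨le_min (Real.exp_pos _).le zero_le_one, min_le_right _ _⟩

lemma proposalAcceptance_expansion (hV : SmoothPeriodic L (lift V)) (β : ℝ) :
    ∃ C, 0 ≤ C ∧ ∀ dt : ℝ, 0 < dt → dt ≤ 1 → ∀ (q : Torus L N d) (g : Ambient N d),
      |proposalAcceptance β V dt q g - 1 + √dt ^ 3 * rejectionCoeff β (lift V) (rep q) g|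
        ≤ C * dt ^ 2 * (1 + ‖g‖) ^ 8 := by
  obtain ⟨C, hC0, hC⟩ := hV.acceptance_expansion β
  refine ⟨C, hC0, fun dt hdt hdt1 q g => ?_⟩
  have h := hC √dt (rep q) g (Real.sqrt_nonneg _) (Real.sqrt_le_one.2 hdt1)
  rw [show √dt ^ 4 = (√dt ^ 2) ^ 2 by ring, Real.sq_sqrt hdt.le] at h
  rwa [proposalAcceptance_eq β V hdt]

lemma rpow_three_halves {dt : ℝ} (hdt : 0 ≤ dt) : dt ^ (3 / 2 : ℝ) = √dt ^ 3 := by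
  rw [Real.sqrt_eq_rpow, ← Real.rpow_natCast, ← Real.rpow_mul hdt]
  norm_num

lemma measurable_section {F : Torus L N d × Ambient N d → ℝ} (hF : Measurable F)
    (q : Torus L N d) : Measurable fun g => F (q, g) :=
  hF.comp measurable_prodMk_left

lemma integral_abs_pow_le {D : Ambient N d → ℝ} (hD : Measurable D) {A : ℝ} {k : ℕ}
    (h : ∀ g, |D g| ≤ A * (1 + ‖g‖) ^ k) (p : ℕ) :
    Integrable (fun g => |D g| ^ p) (stdGaussian (Ambient N d)) ∧
      ∫ g, |D g| ^ p ∂(stdGaussian (Ambient N d)) ≤ A ^ p * absMoment (Ambient N d) (k * p) := by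
  have hpow : ∀ g, ‖|D g| ^ p‖ ≤ A ^ p * (1 + ‖g‖) ^ (k * p) := by
    intro g
    rw [norm_pow, Real.norm_eq_abs, abs_abs, pow_mul, ← mul_pow]
    exact pow_le_pow_left₀ (abs_nonneg _) (h g) p
  have hm : Measurable fun g => |D g| ^ p := (continuous_abs.measurable.comp hD).pow_const p
  exact ⟨integrable_of_norm_le hm.aestronglyMeasurable hpow,
    (le_abs_self _).trans (norm_integral_le_absMoment hpow)⟩

lemma integrable_proposalAcceptance (hV : SmoothPeriodic L (lift V)) (β : ℝ) {dt : ℝ}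
    (hdt : 0 < dt) (q : Torus L N d) :
    Integrable (fun g => proposalAcceptance β V dt q g) (stdGaussian (Ambient N d)) :=
  (integrable_const (1 : ℝ)).mono'
    ((measurable_proposalAcceptance hV β hdt).comp measurable_prodMk_left).aestronglyMeasurable
    (.of_forall fun g => by
      obtain ⟨h0, h1⟩ := proposalAcceptance_mem β V hdt q g
      rwa [Real.norm_eq_abs, abs_of_nonneg h0])

lemma measurable_comp_rep {F : Ambient N d × Ambient N d → ℝ} (hF : Measurable F) :
    Measurable fun p : Torus L N d × Ambient N d => F (rep p.1, p.2) :=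
  hF.comp ((measurable_rep.comp measurable_fst).prodMk measurable_snd)

lemma measurable_rejectionCoeff (hV : SmoothPeriodic L (lift V)) (β : ℝ) :
    Measurable fun p : Torus L N d × Ambient N d => rejectionCoeff β (lift V) (rep p.1) p.2 :=
  measurable_comp_rep (hV.continuous_rejectionCoeff β).measurable

lemma integrable_rejectionCoeff (hV : SmoothPeriodic L (lift V)) (β : ℝ) (q : Torus L N d) :
    Integrable (fun g => rejectionCoeff β (lift V) (rep q) g) (stdGaussian (Ambient N d)) := by
  obtain ⟨B, -, hB⟩ := hV.rejectionCoeff_bound β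
  exact integrable_of_norm_le
    ((measurable_rejectionCoeff hV β).comp measurable_prodMk_left).aestronglyMeasurable
    (hB (rep q))

lemma integral_proposalAcceptance_sub (hV : SmoothPeriodic L (lift V)) (β : ℝ) {dt : ℝ}
    (hdt : 0 < dt) (q : Torus L N d) (c : ℝ) :
    (∫ g, proposalAcceptance β V dt q g ∂(stdGaussian (Ambient N d))) - 1
        + c * ∫ g, rejectionCoeff β (lift V) (rep q) g ∂(stdGaussian (Ambient N d))
      = ∫ g, (proposalAcceptance β V dt q g - 1
          + c * rejectionCoeff β (lift V) (rep q) g) ∂(stdGaussian (Ambient N d)) := by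
  have h := integrable_proposalAcceptance hV β hdt q
  have h' : Integrable (fun g => proposalAcceptance β V dt q g - 1) (stdGaussian (Ambient N d)) :=
    h.sub (integrable_const _)
  rw [integral_add h' ((integrable_rejectionCoeff hV β q).const_mul _),
    integral_sub h (integrable_const _), integral_const_mul]
  simp

lemma rejection_moments (hV : SmoothPeriodic L (lift V)) (β : ℝ) (p : ℕ) :
    ∃ C : ℝ, 0 ≤ C ∧ ∀ dt : ℝ, 0 < dt → dt ≤ 1 → ∀ q : Torus L N d,
      Integrable (fun g => |proposalAcceptance β V dt q g - 1
          + dt ^ (3 / 2 : ℝ) * rejectionCoeff β (lift V) (rep q) g| ^ p)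
          (stdGaussian (Ambient N d)) ∧
      ∫ g, |proposalAcceptance β V dt q g - 1
          + dt ^ (3 / 2 : ℝ) * rejectionCoeff β (lift V) (rep q) g| ^ p
        ∂(stdGaussian (Ambient N d)) ≤ C * dt ^ (2 * p) ∧
      |(∫ g, proposalAcceptance β V dt q g ∂(stdGaussian (Ambient N d))) - 1
          + dt ^ (3 / 2 : ℝ) * ∫ g, rejectionCoeff β (lift V) (rep q) g
            ∂(stdGaussian (Ambient N d))| ^ p ≤ C * dt ^ (2 * p) := by
  obtain ⟨C, hC0, hC⟩ := proposalAcceptance_expansion hV β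
  have hm := absMoment_nonneg (E := Ambient N d)
  have hC1 : 0 ≤ C ^ p * absMoment (Ambient N d) (8 * p) := mul_nonneg (pow_nonneg hC0 _) (hm _)
  have hC2 : 0 ≤ (C * absMoment (Ambient N d) 8) ^ p := pow_nonneg (mul_nonneg hC0 (hm _)) _
  -- The first summand bounds the `p`-th moment of the error, the second the `p`-th power of its
  -- mean; their sum serves both estimates.
  refine ⟨C ^ p * absMoment (Ambient N d) (8 * p) + (C * absMoment (Ambient N d) 8) ^ p,
    add_nonneg hC1 hC2, fun dt hdt hdt1 q => ?_⟩
  rw [rpow_three_halves hdt.le, integral_proposalAcceptance_sub hV β hdt q]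
  have hmeas : Measurable fun g => proposalAcceptance β V dt q g - 1
      + √dt ^ 3 * rejectionCoeff β (lift V) (rep q) g :=
    (((measurable_proposalAcceptance hV β hdt).comp measurable_prodMk_left).sub_const 1).add
      (((measurable_rejectionCoeff hV β).comp measurable_prodMk_left).const_mul _)
  have hbd := hC dt hdt hdt1 q
  have hdtp : 0 ≤ dt ^ (2 * p) := by positivity
  obtain ⟨h1, h2⟩ := integral_abs_pow_le hmeas hbd p
  refine ⟨h1, h2.trans ?_, ?_⟩
  · rw [mul_pow, ← pow_mul, mul_right_comm]
    exact mul_le_mul_of_nonneg_right (le_add_of_nonneg_right hC2) hdtp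
  · have h := norm_integral_le_absMoment (fun g => (Real.norm_eq_abs _).trans_le (hbd g))
    rw [Real.norm_eq_abs, mul_right_comm] at h
    refine (pow_le_pow_left₀ (abs_nonneg _) h p).trans ?_
    rw [mul_pow, ← pow_mul]
    exact mul_le_mul_of_nonneg_right (le_add_of_nonneg_left hC1) hdtp

end Rejection

end MetropolizedEM

namespace MetropolizedEM

/-! ### Weak expansion of the Euler-Maruyama step and of the rejection correction. -/

section Expansion

variable {L : ℝ} {N d : ℕ}

/-- The Laplacian, as the second Gaussian moment of the Hessian. -/
noncomputable def lap (f : Ambient N d → ℝ) (x : Ambient N d) : ℝ :=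
  moment (Ambient N d) 2 (iteratedFDeriv ℝ 2 f x)

/-- The fourth Gaussian moment of the fourth derivative. -/
noncomputable def biLap (f : Ambient N d → ℝ) (x : Ambient N d) : ℝ :=
  moment (Ambient N d) 4 (iteratedFDeriv ℝ 4 f x)

/-- The correlation `𝔼 [ζ(x, g) g]` of the leading term of the Metropolis ratio with the
Gaussian increment. -/
noncomputable def rejectionDrift (β : ℝ) (W : Ambient N d → ℝ) (x : Ambient N d) : Ambient N d :=
  (β / 12 * √2 ^ 3) • vectorMoment (Ambient N d) 3 (iteratedFDeriv ℝ 3 W x)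
    - (β ^ 2 / 4 * √2) • vectorMoment (Ambient N d) 1
      (iteratedFDeriv ℝ 1 (fun x => ‖gradient W x‖ ^ 2) x)

/-- The second order term in the weak expansion of the Euler-Maruyama scheme. -/
noncomputable def eulerSecondOrder (β : ℝ) (W f : Ambient N d → ℝ) (x : Ambient N d) : ℝ :=
  1 / 2 * fderiv ℝ (fderiv ℝ f) x (β • gradient W x) (β • gradient W x)
    - fderiv ℝ (lap f) x (β • gradient W x) + 1 / 6 * biLap f x

/-- The second order term in the weak expansion of the Metropolized scheme. -/
noncomputable def secondOrder (β : ℝ) (W f : Ambient N d → ℝ) (x : Ambient N d) : ℝ :=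
  eulerSecondOrder β W f x + √2 / 2 * fderiv ℝ f x (rejectionDrift β W x)

namespace SmoothPeriodic

variable {W f : Ambient N d → ℝ}

lemma lap (hf : SmoothPeriodic L f) : SmoothPeriodic L (lap f) :=
  (hf.iteratedFDeriv 2).clm_comp _

lemma biLap (hf : SmoothPeriodic L f) : SmoothPeriodic L (biLap f) :=
  (hf.iteratedFDeriv 4).clm_comp _

lemma rejectionDrift (hW : SmoothPeriodic L W) (β : ℝ) :
    SmoothPeriodic L (rejectionDrift β W) :=
  (((hW.iteratedFDeriv 3).clm_comp _).const_smul _).sub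
    (((hW.gradient.norm_sq.iteratedFDeriv 1).clm_comp _).const_smul _)

lemma eulerSecondOrder (hW : SmoothPeriodic L W) (hf : SmoothPeriodic L f) (β : ℝ) :
    SmoothPeriodic L (eulerSecondOrder β W f) :=
  ((((hf.fderiv.fderiv.clm_apply (hW.gradient.const_smul β)).clm_apply
    (hW.gradient.const_smul β)).const_smul (1 / 2)).sub
    (hf.lap.fderiv.clm_apply (hW.gradient.const_smul β))).add (hf.biLap.const_smul (1 / 6))

lemma secondOrder (hW : SmoothPeriodic L W) (hf : SmoothPeriodic L f) (β : ℝ) :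
    SmoothPeriodic L (secondOrder β W f) :=
  (hW.eulerSecondOrder hf β).add
    ((hf.fderiv.clm_apply (hW.rejectionDrift β)).const_smul (√2 / 2))

end SmoothPeriodic

section Linear

variable {W f g : Ambient N d → ℝ}

lemma SmoothPeriodic.lap_add (hf : SmoothPeriodic L f) (hg : SmoothPeriodic L g) :
    MetropolizedEM.lap (f + g) = MetropolizedEM.lap f + MetropolizedEM.lap g := by
  funext x
  simp only [MetropolizedEM.lap, Pi.add_apply]
  rw [iteratedFDeriv_add_apply (hf.contDiff_nat 2).contDiffAt (hg.contDiff_nat 2).contDiffAt,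
    map_add]

lemma SmoothPeriodic.secondOrder_add (hf : SmoothPeriodic L f) (hg : SmoothPeriodic L g) (β : ℝ)
    (x : Ambient N d) : MetropolizedEM.secondOrder β W (f + g) x =
      MetropolizedEM.secondOrder β W f x + MetropolizedEM.secondOrder β W g x := by
  have h1 : _root_.fderiv ℝ (f + g) = _root_.fderiv ℝ f + _root_.fderiv ℝ g :=
    funext fun x => fderiv_add (hf.differentiable x) (hg.differentiable x)
  simp only [MetropolizedEM.secondOrder, MetropolizedEM.eulerSecondOrder, MetropolizedEM.biLap]
  rw [hf.lap_add hg, h1, fderiv_add (hf.fderiv.differentiable x) (hg.fderiv.differentiable x),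
    fderiv_add (hf.lap.differentiable x) (hg.lap.differentiable x),
    iteratedFDeriv_add_apply (hf.contDiff_nat 4).contDiffAt (hg.contDiff_nat 4).contDiffAt,
    map_add]
  simp only [Pi.add_apply, add_apply]
  ring

lemma SmoothPeriodic.lap_smul (hf : SmoothPeriodic L f) (c : ℝ) :
    MetropolizedEM.lap (c • f) = c • MetropolizedEM.lap f := by
  funext x
  simp only [MetropolizedEM.lap, Pi.smul_apply]
  rw [iteratedFDeriv_const_smul_apply (hf.contDiff_nat 2).contDiffAt, map_smul]

lemma SmoothPeriodic.secondOrder_smul (hf : SmoothPeriodic L f) (β c : ℝ)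
    (x : Ambient N d) : MetropolizedEM.secondOrder β W (c • f) x =
      c * MetropolizedEM.secondOrder β W f x := by
  have h1 : _root_.fderiv ℝ (c • f) = c • _root_.fderiv ℝ f :=
    funext fun x => fderiv_const_smul (hf.differentiable x) c
  simp only [MetropolizedEM.secondOrder, MetropolizedEM.eulerSecondOrder, MetropolizedEM.biLap]
  rw [hf.lap_smul, h1, fderiv_const_smul (hf.fderiv.differentiable x),
    fderiv_const_smul (hf.lap.differentiable x),
    iteratedFDeriv_const_smul_apply (hf.contDiff_nat 4).contDiffAt,
    map_smul (moment (Ambient N d) 4)]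
  simp only [Pi.smul_apply, smul_apply, smul_eq_mul]
  ring

end Linear

/-- Write `max (-ζ) 0 = (|ζ| - ζ) / 2`. The product of `ℓ` and `|ζ|` is odd and averages to zero,
leaving an expression without absolute values, hence smooth in `x`. -/
lemma integral_clm_mul_rejectionCoeff [Fact (0 < L)] {W : Ambient N d → ℝ}
    (hW : SmoothPeriodic L W) (β : ℝ) (x : Ambient N d) (ℓ : Ambient N d →L[ℝ] ℝ) :
    ∫ g, ℓ g * rejectionCoeff β W x g ∂(stdGaussian (Ambient N d)) =
      -(1 / 2) * ℓ (rejectionDrift β W x) := by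
  have hodd : ∫ g, ℓ g * |leadingTerm β W x g| ∂(stdGaussian (Ambient N d)) = 0 :=
    integral_eq_zero_of_odd fun g => by
      rw [leadingTerm_neg, abs_neg, map_neg, neg_mul]
  obtain ⟨C, hC0, hC⟩ := hW.leadingTerm_bound β
  have hcont : Continuous fun g => leadingTerm β W x g :=
    (hW.continuous_leadingTerm β).comp (by fun_prop : Continuous fun g => (x, g))
  have hb : ∀ g, ‖ℓ g * leadingTerm β W x g‖ ≤ ‖ℓ‖ * C * (1 + ‖g‖) ^ 4 := by
    intro g
    rw [norm_mul, Real.norm_eq_abs (leadingTerm β W x g)]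
    calc _ ≤ (‖ℓ‖ * (1 + ‖g‖)) * (C * (1 + ‖g‖) ^ 3) := by
          refine mul_le_mul ((ℓ.le_opNorm g).trans ?_) (hC x g) (abs_nonneg _) (by positivity)
          gcongr
          linarith
      _ = _ := by ring
  have h1 : Integrable (fun g => ℓ g * leadingTerm β W x g) (stdGaussian (Ambient N d)) :=
    integrable_of_norm_le (ℓ.continuous.mul hcont).aestronglyMeasurable hb
  have h2 : Integrable (fun g => ℓ g * |leadingTerm β W x g|) (stdGaussian (Ambient N d)) :=
    integrable_of_norm_le (ℓ.continuous.mul hcont.abs).aestronglyMeasurable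
      (fun g => by simpa using hb g)
  have e : ∀ g, ℓ g * rejectionCoeff β W x g =
      1 / 2 * (ℓ g * |leadingTerm β W x g|) - 1 / 2 * (ℓ g * leadingTerm β W x g) := by
    intro g
    rw [rejectionCoeff]
    rcases le_total 0 (leadingTerm β W x g) with h | h
    · rw [max_eq_right (by linarith), abs_of_nonneg h]; ring
    · rw [max_eq_left (by linarith), abs_of_nonpos h]; ring
  simp_rw [e]
  rw [integral_sub (h2.const_mul _) (h1.const_mul _), integral_const_mul, integral_const_mul,
    hodd, rejectionDrift, map_sub, map_smul, map_smul, clm_vectorMoment, clm_vectorMoment]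
  have h3 : ∀ {k : ℕ} (M : (Ambient N d) [×k]→L[ℝ] ℝ),
      Integrable (fun g => ℓ g * M (fun _ => g)) (stdGaussian (Ambient N d)) := by
    intro k M
    refine (ℓ.integrable_comp (integrable_multilinear_diag_smul M)).congr (.of_forall fun g => ?_)
    simp [mul_comm]
  have e2 : ∀ g, ℓ g * leadingTerm β W x g =
      β / 12 * √2 ^ 3 * (ℓ g * iteratedFDeriv ℝ 3 W x (fun _ => g))
      - β ^ 2 / 4 * √2 * (ℓ g * iteratedFDeriv ℝ 1 (fun x => ‖gradient W x‖ ^ 2) x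
        (fun _ => g)) := by
    intro g
    rw [leadingTerm]
    ring
  simp_rw [e2]
  rw [integral_sub ((h3 _).const_mul _) ((h3 _).const_mul _), integral_const_mul,
    integral_const_mul]
  simp only [smul_eq_mul]
  ring

lemma continuous_proposal_right (W : Ambient N d → ℝ) (β s : ℝ)
    (x : Ambient N d) : Continuous fun g => proposal β W s x g := by
  unfold proposal
  fun_prop

lemma SmoothPeriodic.continuous_leadingTerm_right {W : Ambient N d → ℝ}
    (hW : SmoothPeriodic L W) (β : ℝ) (x : Ambient N d) :
    Continuous fun g => leadingTerm β W x g :=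
  (hW.continuous_leadingTerm β).comp (by fun_prop : Continuous fun g => (x, g))

lemma SmoothPeriodic.continuous_rejectionCoeff_right {W : Ambient N d → ℝ}
    (hW : SmoothPeriodic L W) (β : ℝ) (x : Ambient N d) :
    Continuous fun g => rejectionCoeff β W x g :=
  (hW.continuous_leadingTerm_right β x).neg.max continuous_const

namespace SmoothPeriodic

variable [Fact (0 < L)] {W f : Ambient N d → ℝ}

/-- Odd orders of the Taylor expansion average to zero. The even ones carry `√2² / 2! = 1` and `√2⁴
/ 4! = 1 / 6`. -/
lemma integral_gaussian_shift (hf : SmoothPeriodic L f) :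
    ∃ C, 0 ≤ C ∧ ∀ (s : ℝ) (x : Ambient N d), 0 ≤ s →
      |(∫ g, f (x + (√2 * s) • g) ∂(stdGaussian (Ambient N d)))
        - (f x + s ^ 2 * MetropolizedEM.lap f x + s ^ 4 * (1 / 6 * MetropolizedEM.biLap f x))|
      ≤ C * s ^ 5 := by
  obtain ⟨C, hC0, hC⟩ := hf.taylor 4
  obtain ⟨B, hB0, hB⟩ := hf.bounded
  refine ⟨C * √2 ^ 5 * absMoment (Ambient N d) 5, mul_nonneg (by positivity) (absMoment_nonneg _),
    fun s x hs => ?_⟩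
  set T : Ambient N d → ℝ := fun g => ∑ k ∈ Finset.range (4 + 1), ((k.factorial : ℝ)⁻¹ •
    ((√2 * s) ^ k * _root_.iteratedFDeriv ℝ k f x (fun _ => g))) with hT
  have hb : ∀ g, ‖f (x + (√2 * s) • g) - T g‖ ≤ C * √2 ^ 5 * s ^ 5 * (1 + ‖g‖) ^ 5 := by
    intro g
    have h := hC x ((√2 * s) • g)
    have e : ∀ k, _root_.iteratedFDeriv ℝ k f x (fun _ => (√2 * s) • g) =
        (√2 * s) ^ k * _root_.iteratedFDeriv ℝ k f x (fun _ => g) := by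
      intro k
      have := (_root_.iteratedFDeriv ℝ k f x).map_smul_univ (fun _ => √2 * s) (fun _ => g)
      simpa using this
    simp only [e] at h
    refine h.trans ?_
    rw [norm_smul, Real.norm_eq_abs, abs_of_nonneg (by positivity)]
    calc C * (√2 * s * ‖g‖) ^ (4 + 1) = C * √2 ^ 5 * s ^ 5 * ‖g‖ ^ 5 := by ring
      _ ≤ _ := by gcongr; linarith
  have hTint : ∀ k ∈ Finset.range (4 + 1), Integrable (fun g => (k.factorial : ℝ)⁻¹ •
      ((√2 * s) ^ k * _root_.iteratedFDeriv ℝ k f x (fun _ => g))) (stdGaussian (Ambient N d)) :=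
    fun k _ => ((integrable_multilinear_diag _).const_mul _).const_mul _
  have hfint : Integrable (fun g => f (x + (√2 * s) • g)) (stdGaussian (Ambient N d)) :=
    (integrable_const B).mono' (hf.continuous.comp (by fun_prop)).aestronglyMeasurable
      (.of_forall fun g => hB _)
  have m0 : ∫ g, _root_.iteratedFDeriv ℝ 0 f x (fun _ => g) ∂(stdGaussian (Ambient N d)) = f x := by
    simp [iteratedFDeriv_zero_apply]
  have e2 : ∫ g, T g ∂(stdGaussian (Ambient N d)) =
      f x + s ^ 2 * MetropolizedEM.lap f x + s ^ 4 * (1 / 6 * MetropolizedEM.biLap f x) := by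
    rw [hT, integral_finsetSum _ hTint]
    simp only [smul_eq_mul, integral_const_mul, Finset.sum_range_succ, Finset.sum_range_zero]
    rw [integral_multilinear_odd (k := 1) (by decide),
      integral_multilinear_odd (k := 3) (by decide), ← moment_apply (k := 2),
      ← moment_apply (k := 4), m0]
    simp only [Nat.factorial, mul_pow, MetropolizedEM.lap, MetropolizedEM.biLap]
    rw [show √2 ^ 4 = (√2 ^ 2) ^ 2 by ring, Real.sq_sqrt zero_le_two]
    simp
    ring
  have h := norm_integral_le_absMoment hb
  rw [integral_sub hfint (integrable_finsetSum _ hTint), e2, Real.norm_eq_abs] at h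
  calc _ ≤ _ := h
    _ = _ := by ring

/-- The weak expansion of one step of the Euler-Maruyama scheme. -/
lemma euler_expansion (hW : SmoothPeriodic L W) (hf : SmoothPeriodic L f) (β : ℝ) :
    ∃ C, 0 ≤ C ∧ ∀ (s : ℝ) (x : Ambient N d), 0 ≤ s → s ≤ 1 →
      |(∫ g, f (x + proposal β W s x g) ∂(stdGaussian (Ambient N d)))
        - (f x + s ^ 2 * (MetropolizedEM.lap f x - _root_.fderiv ℝ f x (β • _root_.gradient W x))
          + s ^ 4 * MetropolizedEM.eulerSecondOrder β W f x)| ≤ C * s ^ 5 := by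
  -- The noise is averaged first, from the base point `x + y` already shifted by the drift `y =
  -- O(s²)`. Then `f`, `lap f` and `biLap f` are expanded in `y` to orders 2, 1 and 0, each with
  -- total error `O(s⁶)`.
  obtain ⟨C, hC0, hC⟩ := hf.integral_gaussian_shift
  obtain ⟨C1, hC10, hC1⟩ := hf.taylor 2
  obtain ⟨C2, hC20, hC2⟩ := hf.lap.taylor 1
  obtain ⟨C3, hC30, hC3⟩ := hf.biLap.taylor 0
  obtain ⟨K, hK0, hK⟩ := (hW.gradient.const_smul β).bounded
  refine ⟨C + C1 * K ^ 3 + C2 * K ^ 2 + 1 / 6 * (C3 * K), by positivity, fun s x hs hs1 => ?_⟩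
  set c := β • _root_.gradient W x with hc
  set y := (-s ^ 2) • c with hy
  have hynorm : ‖y‖ ≤ K * s ^ 2 := by
    rw [hy, norm_smul, norm_neg, Real.norm_eq_abs, abs_of_nonneg (sq_nonneg s), mul_comm]
    exact mul_le_mul_of_nonneg_right (hK x) (sq_nonneg s)
  have e1 : ∀ g, x + proposal β W s x g = x + y + (√2 * s) • g := by
    intro g
    rw [proposal, hy, hc, smul_smul, neg_mul, neg_smul, mul_comm (s ^ 2), add_assoc]
  simp_rw [e1]
  clear_value y c
  have t0 := hC s (x + y) hs
  have t1 := hC1 x y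
  have t2 := hC2 x y
  have t3 := hC3 x y
  simp only [Finset.sum_range_succ, Finset.sum_range_zero, Real.norm_eq_abs, smul_eq_mul,
    Nat.factorial, zero_add, iteratedFDeriv_zero_apply, iteratedFDeriv_one_apply,
    iteratedFDeriv_two_apply] at t1 t2 t3
  have d1 : ∀ ℓ : Ambient N d →L[ℝ] ℝ, ℓ y = -s ^ 2 * ℓ c := fun ℓ => by
    rw [hy, map_smul, smul_eq_mul]
  have d2 : _root_.fderiv ℝ (_root_.fderiv ℝ f) x y y =
      s ^ 4 * _root_.fderiv ℝ (_root_.fderiv ℝ f) x c c := by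
    rw [d1, hy, map_smul, smul_apply, smul_eq_mul]
    ring
  rw [d1, d2] at t1
  rw [d1] at t2
  push_cast at t1 t2 t3
  have p5 : s ^ 6 ≤ s ^ 5 := pow_le_pow_of_le_one hs hs1 (by norm_num)
  have s1 : C1 * ‖y‖ ^ (2 + 1) ≤ C1 * K ^ 3 * s ^ 5 := by
    calc _ ≤ C1 * (K * s ^ 2) ^ (2 + 1) := by gcongr
      _ = C1 * K ^ 3 * s ^ 6 := by ring
      _ ≤ _ := by gcongr
  have s2 : s ^ 2 * (C2 * ‖y‖ ^ (1 + 1)) ≤ C2 * K ^ 2 * s ^ 5 := by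
    calc _ ≤ s ^ 2 * (C2 * (K * s ^ 2) ^ (1 + 1)) := by gcongr
      _ = C2 * K ^ 2 * s ^ 6 := by ring
      _ ≤ _ := by gcongr
  have s3 : s ^ 4 * (1 / 6 * (C3 * ‖y‖ ^ 1)) ≤ 1 / 6 * (C3 * K) * s ^ 5 := by
    calc _ ≤ s ^ 4 * (1 / 6 * (C3 * (K * s ^ 2) ^ 1)) := by gcongr
      _ = 1 / 6 * (C3 * K) * s ^ 6 := by ring
      _ ≤ _ := by gcongr
  have hmul : ∀ {a b e : ℝ}, 0 ≤ a → |b| ≤ e → |a * b| ≤ a * e := fun ha hb => by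
    rw [abs_mul, abs_of_nonneg ha]
    exact mul_le_mul_of_nonneg_left hb ha
  have t1' := t1.trans s1
  have t2' := (hmul (sq_nonneg s) t2).trans s2
  have t3' := (hmul (by positivity : 0 ≤ s ^ 4)
    (hmul (by norm_num : (0 : ℝ) ≤ 1 / 6) t3)).trans s3
  rw [MetropolizedEM.eulerSecondOrder, ← hc]
  rw [abs_le] at t0 t1' t2' t3' ⊢
  constructor <;> linarith [t0.1, t0.2, t1'.1, t1'.2, t2'.1, t2'.2, t3'.1, t3'.2]

/-- The expansion of the effect of the rejections on averages. -/
lemma rejection_expansion (hW : SmoothPeriodic L W) (hf : SmoothPeriodic L f) (β : ℝ) :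
    ∃ C, 0 ≤ C ∧ ∀ (s : ℝ) (x : Ambient N d), 0 ≤ s → s ≤ 1 →
      |(∫ g, (f (x + proposal β W s x g) - f x) *
          (min (Real.exp (logRatio β W (s ^ 2) x (proposal β W s x g))) 1 - 1)
            ∂(stdGaussian (Ambient N d)))
        - s ^ 4 * (√2 / 2 * _root_.fderiv ℝ f x (MetropolizedEM.rejectionDrift β W x))|
      ≤ C * s ^ 5 := by
  obtain ⟨K, hK0, hK⟩ := hW.norm_proposal_le β
  obtain ⟨C0, hC00, hC0⟩ := hf.taylor 0
  obtain ⟨C1, hC10, hC1⟩ := hf.taylor 1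
  obtain ⟨D, hD0, hD⟩ := hf.fderiv.bounded
  obtain ⟨C2, hC20, hC2⟩ := hW.acceptance_expansion β
  obtain ⟨B, hB0, hB⟩ := hW.rejectionCoeff_bound β
  refine ⟨(C0 * K * C2 + (C1 * K ^ 2 + D * K) * B) * absMoment (Ambient N d) 9,
    mul_nonneg (by positivity) (absMoment_nonneg _), fun s x hs hs1 => ?_⟩
  set ℓ := _root_.fderiv ℝ f x with hℓ
  set a : Ambient N d → ℝ := fun g => f (x + proposal β W s x g) - f x with ha
  set b : Ambient N d → ℝ := fun g =>
    min (Real.exp (logRatio β W (s ^ 2) x (proposal β W s x g))) 1 - 1 with hb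
  set ξ : Ambient N d → ℝ := fun g => rejectionCoeff β W x g with hξ
  have hprop := continuous_proposal_right W β s x
  have hacont : Continuous a := (hf.continuous.comp (continuous_const.add hprop)).sub
    continuous_const
  have hbcont : Continuous b := by
    have h : Continuous fun g => logRatio β W (s ^ 2) x (proposal β W s x g) :=
      (hW.continuous_logRatio β (s ^ 2)).comp (continuous_const.prodMk hprop)
    exact ((Real.continuous_exp.comp h).min continuous_const).sub continuous_const
  have hξcont : Continuous ξ := hW.continuous_rejectionCoeff_right β x
  have habd : ∀ g, |a g| ≤ C0 * K * s * (1 + ‖g‖) := by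
    intro g
    have h := hC0 x (proposal β W s x g)
    simp only [Finset.sum_range_succ, Finset.sum_range_zero, Real.norm_eq_abs, smul_eq_mul,
      Nat.factorial, zero_add, iteratedFDeriv_zero_apply, Nat.cast_one, inv_one, one_mul,
      pow_one] at h
    calc _ ≤ _ := h
      _ ≤ C0 * (K * s * (1 + ‖g‖)) := by gcongr; exact (hK s x g hs hs1).1
      _ = _ := by ring
  have had : ∀ g, |a g - √2 * s * ℓ g| ≤ (C1 * K ^ 2 + D * K) * s ^ 2 * (1 + ‖g‖) ^ 2 := by
    intro g
    obtain ⟨k1, -, k3⟩ := hK s x g hs hs1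
    have h := hC1 x (proposal β W s x g)
    simp only [Finset.sum_range_succ, Finset.sum_range_zero, Real.norm_eq_abs, smul_eq_mul,
      Nat.factorial, zero_add, iteratedFDeriv_zero_apply, iteratedFDeriv_one_apply, Nat.cast_one,
      inv_one, one_mul, mul_one] at h
    have h2 : |ℓ (proposal β W s x g - (√2 * s) • g)| ≤ D * (K * s ^ 2) :=
      (ℓ.le_opNorm _).trans (mul_le_mul (hD x) k3 (norm_nonneg _) hD0)
    rw [map_sub, map_smul, smul_eq_mul] at h2
    have hG : 1 ≤ (1 + ‖g‖) ^ 2 := one_le_pow₀ (by linarith [norm_nonneg g])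
    have h3 : C1 * ‖proposal β W s x g‖ ^ (1 + 1) ≤ C1 * K ^ 2 * s ^ 2 * (1 + ‖g‖) ^ 2 := by
      calc _ ≤ C1 * (K * s * (1 + ‖g‖)) ^ (1 + 1) := by gcongr
        _ = _ := by ring
    have h4 : D * (K * s ^ 2) ≤ D * K * s ^ 2 * (1 + ‖g‖) ^ 2 := by
      calc _ = D * K * s ^ 2 * 1 := by ring
        _ ≤ _ := by gcongr
    have e : a g - √2 * s * ℓ g =
        (f (x + proposal β W s x g) - (f x + ℓ (proposal β W s x g)))
        + (ℓ (proposal β W s x g) - √2 * s * ℓ g) := by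
      rw [ha]; ring
    rw [e]
    calc _ ≤ _ := abs_add_le _ _
      _ ≤ C1 * K ^ 2 * s ^ 2 * (1 + ‖g‖) ^ 2 + D * K * s ^ 2 * (1 + ‖g‖) ^ 2 :=
        add_le_add (h.trans h3) (h2.trans h4)
      _ = _ := by ring
  have hmain : ∀ g, ‖a g * b g - (-(√2 * s ^ 4)) * (ℓ g * ξ g)‖ ≤
      (C0 * K * C2 + (C1 * K ^ 2 + D * K) * B) * s ^ 5 * (1 + ‖g‖) ^ 9 := by
    intro g
    -- Here `a ≈ √2 s ℓ` up to `s²` and `b ≈ -s³ ξ` up to `s⁴`; this splitting makes the two errors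
    -- `s · s⁴` and `s² · s³`.
    have e : a g * b g - (-(√2 * s ^ 4)) * (ℓ g * ξ g) =
        a g * (b g + s ^ 3 * ξ g) - (a g - √2 * s * ℓ g) * (s ^ 3 * ξ g) := by ring
    have hG : 1 ≤ 1 + ‖g‖ := by linarith [norm_nonneg g]
    have hG5 : (1 + ‖g‖) ^ 5 ≤ (1 + ‖g‖) ^ 9 := pow_le_pow_right₀ hG (by norm_num)
    rw [e, Real.norm_eq_abs]
    refine (abs_sub _ _).trans ?_
    rw [abs_mul, abs_mul, abs_mul (s ^ 3), abs_of_nonneg (by positivity : 0 ≤ s ^ 3)]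
    calc _ ≤ (C0 * K * s * (1 + ‖g‖)) * (C2 * s ^ 4 * (1 + ‖g‖) ^ 8)
          + ((C1 * K ^ 2 + D * K) * s ^ 2 * (1 + ‖g‖) ^ 2) * (s ^ 3 * (B * (1 + ‖g‖) ^ 3)) := by
          gcongr
          · exact habd g
          · exact hC2 s x g hs hs1
          · exact had g
          · exact hB x g
      _ = C0 * K * C2 * s ^ 5 * (1 + ‖g‖) ^ 9
          + (C1 * K ^ 2 + D * K) * B * s ^ 5 * (1 + ‖g‖) ^ 5 := by ring
      _ ≤ C0 * K * C2 * s ^ 5 * (1 + ‖g‖) ^ 9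
          + (C1 * K ^ 2 + D * K) * B * s ^ 5 * (1 + ‖g‖) ^ 9 := by gcongr
      _ = _ := by ring
  have hint1 : Integrable (fun g => ℓ g * ξ g) (stdGaussian (Ambient N d)) := by
    refine integrable_of_norm_le (C := ‖ℓ‖ * B) (k := 4)
      (ℓ.continuous.mul hξcont).aestronglyMeasurable fun g => ?_
    rw [norm_mul]
    calc _ ≤ (‖ℓ‖ * (1 + ‖g‖)) * (B * (1 + ‖g‖) ^ 3) := by
          refine mul_le_mul ((ℓ.le_opNorm g).trans ?_) (hB x g) (norm_nonneg _) (by positivity)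
          gcongr
          linarith
      _ = _ := by ring
  have hint2 : Integrable (fun g => a g * b g) (stdGaussian (Ambient N d)) := by
    have h := integrable_of_norm_le (((hacont.mul hbcont).sub (continuous_const.mul
      (ℓ.continuous.mul hξcont))).aestronglyMeasurable) hmain
    have h' := h.add (hint1.const_mul (-(√2 * s ^ 4)))
    refine h'.congr (.of_forall fun g => ?_)
    exact sub_add_cancel (a g * b g) _
  have h := norm_integral_le_absMoment hmain
  rw [integral_sub hint2 (hint1.const_mul _), integral_const_mul,
    integral_clm_mul_rejectionCoeff hW β x ℓ, Real.norm_eq_abs] at h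
  calc _ = |(∫ g, a g * b g ∂(stdGaussian (Ambient N d))) - (-(√2 * s ^ 4)) *
        (-(1 / 2) * ℓ (MetropolizedEM.rejectionDrift β W x))| := by congr 1; ring
    _ ≤ _ := h
    _ = _ := by ring

lemma integral_sub_mul {Ω : Type*} [MeasurableSpace Ω] {μ : Measure Ω} [IsProbabilityMeasure μ]
    {a b : Ω → ℝ} {c B : ℝ} (ha : AEStronglyMeasurable a μ) (hb : AEStronglyMeasurable b μ)
    (haB : ∀ ω, |a ω| ≤ B) (hbB : ∀ ω, |b ω - 1| ≤ 1) :
    ∫ ω, (a ω - c) * b ω ∂μ = (∫ ω, a ω ∂μ) - c + ∫ ω, (a ω - c) * (b ω - 1) ∂μ := by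
  have hai : Integrable a μ := (integrable_const B).mono' ha (.of_forall haB)
  have h4 : Integrable (fun ω => a ω - c) μ := hai.sub (integrable_const _)
  have habi : Integrable (fun ω => (a ω - c) * (b ω - 1)) μ :=
    h4.mul_bdd (c := 1) (hb.sub aestronglyMeasurable_const) (.of_forall hbB)
  have h3 : ∀ ω, (a ω - c) * b ω = (a ω - c) + (a ω - c) * (b ω - 1) := fun ω => by ring
  simp_rw [h3]
  rw [integral_add h4 habi, integral_sub hai (integrable_const _)]
  simp

lemma metropolis_expansion (hW : SmoothPeriodic L W) (hf : SmoothPeriodic L f) (β : ℝ) :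
    ∃ C, 0 ≤ C ∧ ∀ (s : ℝ) (x : Ambient N d), 0 ≤ s → s ≤ 1 →
      |(∫ g, (f (x + proposal β W s x g) - f x) *
          min (Real.exp (logRatio β W (s ^ 2) x (proposal β W s x g))) 1
            ∂(stdGaussian (Ambient N d)))
        - (s ^ 2 * (MetropolizedEM.lap f x - _root_.fderiv ℝ f x (β • _root_.gradient W x))
          + s ^ 4 * MetropolizedEM.secondOrder β W f x)| ≤ C * s ^ 5 := by
  obtain ⟨C1, hC10, hC1⟩ := hW.euler_expansion hf β
  obtain ⟨C2, hC20, hC2⟩ := hW.rejection_expansion hf β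
  obtain ⟨B, hB0, hB⟩ := hf.bounded
  refine ⟨C1 + C2, by positivity, fun s x hs0 hs1 => ?_⟩
  have h1 := hC1 s x hs0 hs1
  have h2 := hC2 s x hs0 hs1
  have hprop := continuous_proposal_right W β s x
  have hac : Continuous fun g => f (x + proposal β W s x g) :=
    hf.continuous.comp (continuous_const.add hprop)
  have hlr : Continuous fun g => logRatio β W (s ^ 2) x (proposal β W s x g) :=
    (hW.continuous_logRatio β (s ^ 2)).comp (continuous_const.prodMk hprop)
  have hbc : Continuous fun g =>
      min (Real.exp (logRatio β W (s ^ 2) x (proposal β W s x g))) 1 :=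
    (Real.continuous_exp.comp hlr).min continuous_const
  have hb1 : ∀ g, |min (Real.exp (logRatio β W (s ^ 2) x (proposal β W s x g))) 1 - 1| ≤ 1 := by
    intro g
    have h0 : 0 ≤ min (Real.exp (logRatio β W (s ^ 2) x (proposal β W s x g))) 1 :=
      le_min (Real.exp_pos _).le zero_le_one
    have h1 : min (Real.exp (logRatio β W (s ^ 2) x (proposal β W s x g))) 1 ≤ 1 :=
      min_le_right _ _
    rw [abs_le]
    constructor <;> linarith
  rw [integral_sub_mul hac.aestronglyMeasurable hbc.aestronglyMeasurable (fun g => hB _) hb1,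
    MetropolizedEM.secondOrder]
  rw [abs_le] at h1 h2 ⊢
  constructor <;> linarith [h1.1, h1.2, h2.1, h2.2]

end SmoothPeriodic

end Expansion

end MetropolizedEM

namespace MetropolizedEM

/-! ### The evolution operator as a Gaussian average, and its expansion. -/

section Evolution

variable {L : ℝ} {N d : ℕ} [Fact (0 < L)] {V f : Torus L N d → ℝ}

lemma measurable_of_lift (hf : SmoothPeriodic L (lift f)) : Measurable f := by
  have h : f = fun q => lift f (rep q) := funext fun q => (lift_apply_rep f q).symm
  rw [h]
  exact hf.continuous.measurable.comp measurable_rep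

lemma abs_le_of_lift (hf : SmoothPeriodic L (lift f)) : ∃ B, 0 ≤ B ∧ ∀ q, |f q| ≤ B := by
  obtain ⟨B, hB0, hB⟩ := hf.bounded
  exact ⟨B, hB0, fun q => by simpa [lift_apply_rep] using hB (rep q)⟩

lemma measurable_grad (hV : SmoothPeriodic L (lift V)) : Measurable (grad V) :=
  hV.gradient.continuous.measurable.comp measurable_rep

lemma apply_add_proj (f : Torus L N d → ℝ) (q : Torus L N d) (h : Ambient N d) :
    f (q + proj L h) = lift f (rep q + h) := by
  rw [lift, proj_add, proj_rep]

lemma integral_unit_interval_ite {r a b : ℝ} (h0 : 0 ≤ r) (h1 : r ≤ 1) :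
    ∫ u in Set.Icc (0 : ℝ) 1, (if u ≤ r then a else b) = b + (a - b) * r := by
  have e : ∀ u : ℝ, (if u ≤ r then a else b) = b + (Set.Iic r).indicator (fun _ => a - b) u := by
    intro u
    by_cases hu : u ≤ r
    · simp [hu]
    · simp [hu]
  simp_rw [e]
  rw [integral_add (integrable_const _) ((integrable_const _).indicator measurableSet_Iic),
    integral_indicator measurableSet_Iic, Measure.restrict_restrict measurableSet_Iic,
    show Set.Iic r ∩ Set.Icc (0 : ℝ) 1 = Set.Icc 0 r by
      ext u; simp only [Set.mem_inter_iff, Set.mem_Iic, Set.mem_Icc]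
      exact ⟨fun h => ⟨h.2.1, h.1⟩, fun h => ⟨h.2, h.1, h.2.trans h1⟩⟩]
  simp [h0, mul_comm]

lemma integral_ite_prod {Ω : Type*} [MeasurableSpace Ω] (μ : Measure Ω) [IsProbabilityMeasure μ]
    {a r : Ω → ℝ} {b B : ℝ} (ha : Measurable a) (hr : Measurable r) (h0 : ∀ ω, 0 ≤ r ω)
    (h1 : ∀ ω, r ω ≤ 1) (haB : ∀ ω, |a ω| ≤ B) (hbB : |b| ≤ B) :
    ∫ z, (if z.2 ≤ r z.1 then a z.1 else b) ∂(μ.prod (volume.restrict (Set.Icc (0 : ℝ) 1))) =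
      b + ∫ ω, (a ω - b) * r ω ∂μ := by
  have hB0 : 0 ≤ B := (abs_nonneg b).trans hbB
  have hmeas : Measurable fun z : Ω × ℝ => if z.2 ≤ r z.1 then a z.1 else b :=
    Measurable.ite (measurableSet_le measurable_snd (hr.comp measurable_fst))
      (ha.comp measurable_fst) measurable_const
  have hint : Integrable (fun z : Ω × ℝ => if z.2 ≤ r z.1 then a z.1 else b)
      (μ.prod (volume.restrict (Set.Icc (0 : ℝ) 1))) :=
    (integrable_const B).mono' hmeas.aestronglyMeasurable (.of_forall fun z => by
      split_ifs
      · exact haB _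
      · exact hbB)
  rw [integral_prod _ hint]
  simp_rw [fun ω => integral_unit_interval_ite (a := a ω) (b := b) (h0 ω) (h1 ω)]
  rw [integral_add (integrable_const _)]
  · simp
  · refine (integrable_const (2 * B)).mono'
      ((ha.sub_const _).mul hr).aestronglyMeasurable (.of_forall fun ω => ?_)
    rw [norm_mul, Real.norm_eq_abs, Real.norm_eq_abs, abs_of_nonneg (h0 ω)]
    calc _ ≤ (2 * B) * 1 := by
          refine mul_le_mul ((abs_sub _ _).trans ?_) (h1 ω) (h0 ω) (by positivity)
          linarith [haB ω]
      _ = _ := mul_one _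

/-- By Fubini the uniform variable is integrated first; a move is accepted with conditional
probability equal to the acceptance ratio, which lies in `[0, 1]`. -/
lemma evolution_eq (hV : SmoothPeriodic L (lift V)) (hf : SmoothPeriodic L (lift f)) (β : ℝ)
    {dt : ℝ} (hdt : 0 < dt) (q : Torus L N d) :
    evolution β V dt f q = f q + ∫ g, (f (q + proj L (increment β V dt q g)) - f q) *
      proposalAcceptance β V dt q g ∂(stdGaussian (Ambient N d)) := by
  obtain ⟨B, hB0, hB⟩ := abs_le_of_lift hf
  have hR : Measurable fun g => proposalAcceptance β V dt q g :=
    measurable_section (measurable_proposalAcceptance hV β hdt) q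
  have hi : Measurable fun g => increment β V dt q g := by
    unfold increment
    fun_prop
  have hinc : Measurable fun g => f (q + proj L (increment β V dt q g)) :=
    (measurable_of_lift hf).comp ((measurable_proj.comp hi).const_add q)
  have hstep : ∀ g u, f (step β V dt q g u) = if u ≤ proposalAcceptance β V dt q g then
      f (q + proj L (increment β V dt q g)) else f q := by
    intro g u
    rw [step]
    split_ifs <;> rfl
  rw [evolution]
  simp_rw [hstep]
  exact integral_ite_prod (stdGaussian (Ambient N d)) hinc hR
    (fun g => (proposalAcceptance_mem β V hdt q g).1)
    (fun g => (proposalAcceptance_mem β V hdt q g).2) (fun g => hB _) (hB q)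

lemma generator_eq (β : ℝ) (V f : Torus L N d → ℝ) (q : Torus L N d) :
    generator β V f q = lap (lift f) (rep q)
      - fderiv ℝ (lift f) (rep q) (β • gradient (lift V) (rep q)) := by
  rw [generator, grad, grad, inner_gradient, laplacian_eq_moment, map_smul, smul_eq_mul, lap]
  ring

/-- The weak expansion of one step of the Metropolized scheme. -/
theorem evolution_expansion (hV : SmoothPeriodic L (lift V)) (hf : SmoothPeriodic L (lift f))
    (β : ℝ) : ∃ C, 0 ≤ C ∧ ∀ dt : ℝ, 0 < dt → dt ≤ 1 → ∀ q,
      |evolution β V dt f q - (f q + dt * generator β V f q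
        + dt ^ 2 * secondOrder β (lift V) (lift f) (rep q))| ≤ C * √dt ^ 5 := by
  obtain ⟨C, hC0, hC⟩ := hV.metropolis_expansion hf β
  refine ⟨C, hC0, fun dt hdt hdt1 q => ?_⟩
  have h := hC √dt (rep q) (Real.sqrt_nonneg dt) (Real.sqrt_le_one.2 hdt1)
  rw [show √dt ^ 4 = (√dt ^ 2) ^ 2 by ring, Real.sq_sqrt hdt.le, lift_apply_rep] at h
  rw [evolution_eq hV hf β hdt q, generator_eq, add_assoc, add_sub_add_left_eq_sub]
  simp_rw [apply_add_proj, proposalAcceptance_eq β V hdt, increment_eq_proposal β V hdt.le]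
  exact h

end Evolution

/-! ### Detailed balance and invariance of the Gibbs measure. -/

section Invariance

variable {L : ℝ} {N d : ℕ} [Fact (0 < L)] {V f : Torus L N d → ℝ}

/-- The unnormalized density of the pair (position, proposed increment) at equilibrium. -/
noncomputable def pairWeight (β : ℝ) (V : Torus L N d → ℝ) (dt : ℝ) (h : Ambient N d)
    (q : Torus L N d) : ℝ :=
  Real.exp (-β * V q) * Real.exp (-(‖h + (β * dt) • grad V q‖ ^ 2 / (4 * dt)))

lemma pairWeight_pos (β : ℝ) (V : Torus L N d → ℝ) (dt : ℝ) (h : Ambient N d)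
    (q : Torus L N d) : 0 < pairWeight β V dt h q :=
  mul_pos (Real.exp_pos _) (Real.exp_pos _)

lemma measurable_pairWeight (hV : SmoothPeriodic L (lift V)) (β dt : ℝ) :
    Measurable fun p : Ambient N d × Torus L N d => pairWeight β V dt p.1 p.2 := by
  unfold pairWeight
  have h1 := measurable_of_lift hV
  have h2 := measurable_grad hV
  fun_prop

/-- The drift is bounded, so giving up half of the Gaussian exponent absorbs it. This provides the
integrable majorant for Fubini. -/
lemma pairWeight_le (hV : SmoothPeriodic L (lift V)) (β : ℝ) {dt : ℝ} (hdt : 0 < dt) :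
    ∃ C, ∀ h (q : Torus L N d),
      pairWeight β V dt h q ≤ C * Real.exp (-(1 / (8 * dt)) * ‖h‖ ^ 2) := by
  obtain ⟨B, hB0, hB⟩ := abs_le_of_lift hV
  obtain ⟨K, hK0, hK⟩ := (hV.gradient.const_smul (β * dt)).bounded
  refine ⟨Real.exp (|β| * B) * Real.exp (K ^ 2 / (4 * dt)), fun h q => ?_⟩
  rw [pairWeight, mul_assoc, ← Real.exp_add (K ^ 2 / (4 * dt))]
  refine mul_le_mul (Real.exp_le_exp.2 ?_) (Real.exp_le_exp.2 ?_) (Real.exp_pos _).le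
    (Real.exp_pos _).le
  · calc -β * V q ≤ |(-β) * V q| := le_abs_self _
      _ ≤ _ := by rw [abs_mul, abs_neg]; gcongr; exact hB q
  · have hk : ‖(β * dt) • grad V q‖ ≤ K := hK (rep q)
    set a := (β * dt) • grad V q
    have h1 : ‖h‖ ≤ ‖h + a‖ + ‖a‖ := by simpa using norm_sub_le (h + a) a
    have h2 : ‖h‖ ^ 2 ≤ 2 * ‖h + a‖ ^ 2 + 2 * K ^ 2 := by
      nlinarith [sq_nonneg (‖h + a‖ - K), norm_nonneg h, norm_nonneg a, norm_nonneg (h + a)]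
    have e : K ^ 2 / (4 * dt) + -(1 / (8 * dt)) * ‖h‖ ^ 2 - -(‖h + a‖ ^ 2 / (4 * dt)) =
        (2 * ‖h + a‖ ^ 2 + 2 * K ^ 2 - ‖h‖ ^ 2) / (8 * dt) := by
      field_simp
      ring
    have : 0 ≤ (2 * ‖h + a‖ ^ 2 + 2 * K ^ 2 - ‖h‖ ^ 2) / (8 * dt) := by
      apply div_nonneg <;> linarith
    linarith

/-- The ratio compares a move with its reverse, tracked by the unprojected increment `h`. Distinct
increments with the same endpoint on the torus are kept apart, so no sum over lattice translates is
needed. -/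
lemma acceptance_rep (hV : SmoothPeriodic L (lift V)) (β : ℝ) {dt : ℝ} (hdt : 0 < dt)
    (h : Ambient N d) (q : Torus L N d) :
    acceptance β V dt (rep q) (rep q + h) =
      min (pairWeight β V dt (-h) (q + proj L h) / pairWeight β V dt h q) 1 := by
  have hc : (1 / (4 * Real.pi * dt)) ^ (((d * N : ℕ) : ℝ) / 2) ≠ 0 := by
    have : 0 < 1 / (4 * Real.pi * dt) := by positivity
    positivity
  have hg : gradient (lift V) (rep q + h) = grad V (q + proj L h) :=
    hV.gradient.eq_of_proj_eq (by rw [proj_add, proj_rep, proj_rep])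
  unfold acceptance transitionDensity pairWeight
  rw [mul_left_comm, mul_left_comm (Real.exp (-β * lift V (rep q))), mul_div_mul_left _ _ hc,
    ← apply_add_proj, lift_apply_rep, hg, add_sub_cancel_left,
    show rep q - (rep q + h) = -h by abel]
  rfl

/-- The integrand of the detailed balance relation. -/
noncomputable def balanceIntegrand (β : ℝ) (V f : Torus L N d → ℝ) (dt : ℝ)
    (p : Ambient N d × Torus L N d) : ℝ :=
  (f (p.2 + proj L p.1) - f p.2) *
    min (pairWeight β V dt (-p.1) (p.2 + proj L p.1)) (pairWeight β V dt p.1 p.2)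

/-- The exchange of the initial and final positions of a move. -/
def reverseMove (p : Ambient N d × Torus L N d) : Ambient N d × Torus L N d :=
  (-p.1, p.2 + proj L p.1)

/-- This is detailed balance: the minimum of the two weights is symmetric under reversal, while the
increment of `f` changes sign. -/
lemma balanceIntegrand_reverseMove (β : ℝ) (V f : Torus L N d → ℝ) (dt : ℝ)
    (p : Ambient N d × Torus L N d) :
    balanceIntegrand β V f dt (reverseMove p) = -balanceIntegrand β V f dt p := by
  simp only [balanceIntegrand, reverseMove, proj_neg, neg_neg, add_neg_cancel_right]
  rw [min_comm]
  ring

/-- Negation preserves Lebesgue measure, and for each fixed `h` translation by `proj L h` preserves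
the measure on the torus. -/
lemma measurePreserving_reverseMove :
    MeasurePreserving (reverseMove : Ambient N d × Torus L N d → Ambient N d × Torus L N d)
      (volume.prod volume) (volume.prod volume) := by
  refine (Measure.measurePreserving_neg (volume : Measure (Ambient N d))).skew_product
    (g := fun h q => q + proj L h) ?_ (.of_forall fun h => map_add_right_eq_self volume _)
  exact measurable_snd.add (measurable_proj.comp measurable_fst)

lemma measurable_balanceIntegrand (hV : SmoothPeriodic L (lift V))
    (hf : SmoothPeriodic L (lift f)) (β dt : ℝ) : Measurable (balanceIntegrand β V f dt) := by
  have h1 := measurable_of_lift hf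
  have h2 := measurable_pairWeight hV β dt
  have h3 : Measurable (reverseMove : Ambient N d × Torus L N d → _) :=
    measurePreserving_reverseMove.measurable
  have h4 : Measurable fun p : Ambient N d × Torus L N d => p.2 + proj L p.1 := h3.snd
  exact ((h1.comp h4).sub (h1.comp measurable_snd)).mul ((h2.comp h3).min h2)

lemma integrable_balanceIntegrand (hV : SmoothPeriodic L (lift V))
    (hf : SmoothPeriodic L (lift f)) (β : ℝ) {dt : ℝ} (hdt : 0 < dt) :
    Integrable (balanceIntegrand β V f dt) (volume.prod volume) := by
  obtain ⟨B, hB0, hB⟩ := abs_le_of_lift hf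
  obtain ⟨C, hC⟩ := pairWeight_le hV β hdt
  have h1 : Integrable (fun p : Ambient N d × Torus L N d =>
      Real.exp (-(1 / (8 * dt)) * ‖p.1‖ ^ 2) * (2 * B * C)) (volume.prod volume) :=
    (integrable_exp_neg_mul_norm_sq (E := Ambient N d) (by positivity : 0 < 1 / (8 * dt))).mul_prod
      (integrable_const (μ := (volume : Measure (Torus L N d))) (2 * B * C))
  refine h1.mono' (measurable_balanceIntegrand hV hf β dt).aestronglyMeasurable
    (.of_forall fun p => ?_)
  rw [balanceIntegrand, norm_mul, Real.norm_eq_abs, Real.norm_eq_abs,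
    abs_of_pos (lt_min (pairWeight_pos _ _ _ _ _) (pairWeight_pos _ _ _ _ _))]
  calc _ ≤ (2 * B) * (C * Real.exp (-(1 / (8 * dt)) * ‖p.1‖ ^ 2)) := by
        refine mul_le_mul ((abs_sub _ _).trans ?_) ((min_le_right _ _).trans (hC _ _))
          (lt_min (pairWeight_pos _ _ _ _ _) (pairWeight_pos _ _ _ _ _)).le (by positivity)
        linarith [hB (p.2 + proj L p.1), hB p.2]
    _ = _ := by ring

lemma integral_balanceIntegrand (hV : SmoothPeriodic L (lift V))
    (hf : SmoothPeriodic L (lift f)) (β dt : ℝ) :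
    ∫ p, balanceIntegrand β V f dt p ∂((volume : Measure (Ambient N d)).prod volume) = 0 := by
  have h := integral_map (μ := (volume : Measure (Ambient N d)).prod volume)
    measurePreserving_reverseMove.measurable.aemeasurable
    (measurable_balanceIntegrand hV hf β dt).aestronglyMeasurable
  rw [measurePreserving_reverseMove.map_eq] at h
  simp_rw [balanceIntegrand_reverseMove] at h
  rw [integral_neg] at h
  linarith

/-- The weighted mean displacement is a partial integral of the detailed balance integrand. -/
lemma exists_evolution_sub_eq (hV : SmoothPeriodic L (lift V)) (hf : SmoothPeriodic L (lift f))
    (β : ℝ) {dt : ℝ} (hdt : 0 < dt) : ∃ c : ℝ, ∀ q,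
      Real.exp (-β * V q) * (evolution β V dt f q - f q) =
        c * ∫ h, balanceIntegrand β V f dt (h, q) := by
  obtain ⟨c, hc⟩ := integral_affine_stdGaussian (E := Ambient N d)
    (Real.sqrt_pos.2 (by positivity : 0 < 2 * dt))
  refine ⟨c, fun q => ?_⟩
  rw [evolution_eq hV hf β hdt, add_sub_cancel_left]
  have h := hc (fun h => (f (q + proj L h) - f q) * acceptance β V dt (rep q) (rep q + h))
    (-((β * dt) • grad V q))
  simp only [proposalAcceptance, increment]
  rw [h, ← integral_const_mul, ← integral_const_mul]
  congr 1
  funext y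
  rw [acceptance_rep hV β hdt, balanceIntegrand, Real.sq_sqrt (by positivity), sub_neg_eq_add,
    show 2 * (2 * dt) = 4 * dt by ring]
  have hw := pairWeight_pos β V dt y q
  -- Weight times acceptance probability is `w min(w'/w, 1) = min(w', w)`, the symmetric form.
  have e : min (pairWeight β V dt (-y) (q + proj L y)) (pairWeight β V dt y q) =
      pairWeight β V dt y q *
        min (pairWeight β V dt (-y) (q + proj L y) / pairWeight β V dt y q) 1 := by
    rw [mul_min_of_nonneg _ _ hw.le, mul_div_cancel₀ _ hw.ne', mul_one]
  simp only [e]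
  nth_rewrite 3 [pairWeight]
  ring

/-- The Boltzmann-Gibbs measure is invariant under the Metropolized scheme. -/
theorem evolution_invariant (hV : SmoothPeriodic L (lift V)) (hf : SmoothPeriodic L (lift f))
    (β : ℝ) {dt : ℝ} (hdt : 0 < dt) :
    Integrable (fun q => Real.exp (-β * V q) * (evolution β V dt f q - f q)) ∧
      ∫ q, Real.exp (-β * V q) * (evolution β V dt f q - f q) = 0 := by
  obtain ⟨c, hc⟩ := exists_evolution_sub_eq hV hf β hdt
  simp_rw [hc]
  have h := integrable_balanceIntegrand hV hf β hdt
  refine ⟨h.integral_prod_right.const_mul c, ?_⟩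
  rw [integral_const_mul, ← integral_prod_symm _ h, integral_balanceIntegrand hV hf, mul_zero]

end Invariance

end MetropolizedEM

namespace MetropolizedEM

/-! ### Vanishing mean of the second order term, and the operator `A`. -/

section SecondOrder

lemma eq_zero_of_abs_le_mul {x K : ℝ} (h : ∀ s : ℝ, 0 < s → s ≤ 1 → |x| ≤ K * s) : x = 0 := by
  by_contra hx
  have hx0 : 0 < |x| := abs_pos.2 hx
  have hD : 0 < |x| + |K| + 1 := by positivity
  -- This `s` lies in `(0, 1]` and satisfies `K * s < |x|`, a contradiction.
  have h1 := h (|x| / (|x| + |K| + 1)) (by positivity)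
    ((div_le_one hD).2 (by linarith [abs_nonneg K]))
  rw [mul_div_assoc', le_div_iff₀ hD] at h1
  nlinarith [le_abs_self K]

/-- Dividing by `s²` and letting `s → 0` gives `ℓ = 0`; then dividing by `s⁴` gives `a = 0`.
Stationarity of the generator is thus a by-product, without integration by parts. -/
lemma eq_zero_of_expansion {ℓ a C : ℝ}
    (h : ∀ s : ℝ, 0 < s → s ≤ 1 → |s ^ 2 * ℓ + s ^ 4 * a| ≤ C * s ^ 5) : a = 0 := by
  have hC : 0 ≤ C := by
    have := (abs_nonneg _).trans (h 1 one_pos le_rfl)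
    simpa using this
  have h1 : ∀ s : ℝ, 0 < s → s ≤ 1 → |ℓ + s ^ 2 * a| ≤ C * s ^ 3 := by
    intro s hs hs1
    have h2 := h s hs hs1
    rw [show s ^ 2 * ℓ + s ^ 4 * a = s ^ 2 * (ℓ + s ^ 2 * a) by ring, abs_mul,
      abs_of_pos (by positivity : 0 < s ^ 2),
      show C * s ^ 5 = s ^ 2 * (C * s ^ 3) by ring] at h2
    exact le_of_mul_le_mul_left h2 (by positivity)
  have hℓ : ℓ = 0 := by
    refine eq_zero_of_abs_le_mul (K := |a| + C) fun s hs hs1 => ?_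
    have h2 : |ℓ| ≤ |ℓ + s ^ 2 * a| + |s ^ 2 * a| := by
      have := abs_sub (ℓ + s ^ 2 * a) (s ^ 2 * a)
      rwa [add_sub_cancel_right] at this
    rw [abs_mul, abs_of_pos (by positivity : 0 < s ^ 2)] at h2
    have h3 : s ^ 3 ≤ s := by simpa using pow_le_pow_of_le_one hs.le hs1 (show 1 ≤ 3 by norm_num)
    have h4 : s ^ 2 ≤ s := by simpa using pow_le_pow_of_le_one hs.le hs1 (show 1 ≤ 2 by norm_num)
    nlinarith [h1 s hs hs1, mul_le_mul_of_nonneg_left h3 hC,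
      mul_le_mul_of_nonneg_right h4 (abs_nonneg a)]
  refine eq_zero_of_abs_le_mul (K := C) fun s hs hs1 => ?_
  have h2 := h1 s hs hs1
  rw [hℓ, zero_add, abs_mul, abs_of_pos (by positivity : 0 < s ^ 2),
    show C * s ^ 3 = s ^ 2 * (C * s) by ring] at h2
  exact le_of_mul_le_mul_left h2 (by positivity)

variable {L : ℝ} {N d : ℕ} [Fact (0 < L)] {V f : Torus L N d → ℝ}

lemma integrable_comp_rep {F : Ambient N d → ℝ} (hF : SmoothPeriodic L F) :
    Integrable fun q : Torus L N d => F (rep q) := by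
  obtain ⟨B, -, hB⟩ := hF.bounded
  exact (integrable_const B).mono' (hF.continuous.measurable.comp measurable_rep).aestronglyMeasurable
    (.of_forall fun q => hB _)

lemma integrable_boltzmann_mul (hV : SmoothPeriodic L (lift V)) (β : ℝ) {F : Ambient N d → ℝ}
    (hF : SmoothPeriodic L F) :
    Integrable fun q : Torus L N d => Real.exp (-β * V q) * F (rep q) := by
  have hw : SmoothPeriodic L fun x : Ambient N d => Real.exp (-β * lift V x) :=
    ⟨(contDiff_const.mul hV.contDiff).exp, fun x k hk => by rw [hV.periodic x k hk]⟩
  have h : SmoothPeriodic L fun x => Real.exp (-β * lift V x) * F x :=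
    ⟨hw.contDiff.mul hF.contDiff, fun x k hk => by rw [hV.periodic x k hk, hF.periodic x k hk]⟩
  simpa only [lift_apply_rep] using integrable_comp_rep h

lemma integral_gibbs (hV : SmoothPeriodic L (lift V)) (β : ℝ) (F : Torus L N d → ℝ) :
    ∫ q, F q ∂(gibbs β V) =
      (partitionFunction β V)⁻¹ * ∫ q, Real.exp (-β * V q) * F q := by
  have hZ : 0 ≤ (partitionFunction β V)⁻¹ :=
    inv_nonneg.2 (integral_nonneg fun q => (Real.exp_pos _).le)
  have hm := measurable_of_lift hV
  rw [gibbs, integral_withDensity_eq_integral_toReal_smul (by fun_prop) (by simp),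
    ← integral_const_mul]
  congr 1
  funext q
  rw [ENNReal.toReal_ofReal (mul_nonneg hZ (Real.exp_pos _).le), smul_eq_mul, mul_assoc]

/-- Exact invariance at every time step `s²` leaves only the remainder when the expansion is
integrated, so `eq_zero_of_expansion` applies. -/
lemma integral_secondOrder (hV : SmoothPeriodic L (lift V)) (hf : SmoothPeriodic L (lift f))
    (β : ℝ) :
    ∫ q : Torus L N d, Real.exp (-β * V q) * secondOrder β (lift V) (lift f) (rep q) = 0 := by
  obtain ⟨C, hC0, hC⟩ := evolution_expansion hV hf β
  obtain ⟨B, hB0, hB⟩ := abs_le_of_lift hV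
  have hA := integrable_boltzmann_mul hV β (hV.secondOrder hf β)
  have hG : Integrable fun q : Torus L N d => Real.exp (-β * V q) * generator β V f q := by
    simp_rw [generator_eq]
    exact integrable_boltzmann_mul hV β
      (hf.lap.sub (hf.fderiv.clm_apply (hV.gradient.const_smul β)))
  refine eq_zero_of_expansion (ℓ := ∫ q, Real.exp (-β * V q) * generator β V f q)
    (C := Real.exp (|β| * B) * C * (volume : Measure (Torus L N d)).real Set.univ)
    fun s hs hs1 => ?_
  have hdt : 0 < s ^ 2 := by positivity
  have hdt1 : s ^ 2 ≤ 1 := pow_le_one₀ hs.le hs1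
  obtain ⟨hP, hP0⟩ := evolution_invariant hV hf β hdt
  have hbd : ∀ q, ‖s ^ 2 * (Real.exp (-β * V q) * generator β V f q)
      + s ^ 4 * (Real.exp (-β * V q) * secondOrder β (lift V) (lift f) (rep q))
      - Real.exp (-β * V q) * (evolution β V (s ^ 2) f q - f q)‖
      ≤ Real.exp (|β| * B) * C * s ^ 5 := by
    intro q
    have h := hC (s ^ 2) hdt hdt1 q
    rw [Real.sqrt_sq hs.le] at h
    have hw : Real.exp (-β * V q) ≤ Real.exp (|β| * B) := by
      refine Real.exp_le_exp.2 ((le_abs_self _).trans ?_)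
      rw [abs_mul, abs_neg]
      gcongr
      exact hB q
    have e : s ^ 2 * (Real.exp (-β * V q) * generator β V f q)
        + s ^ 4 * (Real.exp (-β * V q) * secondOrder β (lift V) (lift f) (rep q))
        - Real.exp (-β * V q) * (evolution β V (s ^ 2) f q - f q) =
        -(Real.exp (-β * V q) * (evolution β V (s ^ 2) f q - (f q + s ^ 2 * generator β V f q
          + (s ^ 2) ^ 2 * secondOrder β (lift V) (lift f) (rep q)))) := by ring
    rw [e, norm_neg, norm_mul, Real.norm_eq_abs, Real.norm_eq_abs, Real.abs_exp, mul_assoc]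
    exact mul_le_mul hw h (abs_nonneg _) (Real.exp_pos _).le
  have h := norm_integral_le_of_norm_le_const (μ := (volume : Measure (Torus L N d)))
    (.of_forall hbd)
  have hsum : Integrable fun q : Torus L N d =>
      s ^ 2 * (Real.exp (-β * V q) * generator β V f q)
      + s ^ 4 * (Real.exp (-β * V q) * secondOrder β (lift V) (lift f) (rep q)) :=
    (hG.const_mul _).add (hA.const_mul _)
  rw [integral_sub hsum hP, hP0, sub_zero,
    integral_add (hG.const_mul _) (hA.const_mul _), integral_const_mul, integral_const_mul,
    Real.norm_eq_abs] at h
  calc _ ≤ _ := h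
    _ = _ := by ring

/-- The second order term of the weak expansion, as an operator on smooth functions on the
periodic box. -/
noncomputable def secondOrderOperator (β : ℝ) (V : Torus L N d → ℝ)
    (hV : SmoothPeriodic L (lift V)) : smoothFunctions L N d →ₗ[ℝ] smoothFunctions L N d where
  toFun ψ := ⟨fun q => secondOrder β (lift V) (lift ψ.1) (rep q), by
    have h := hV.secondOrder (smoothPeriodic_lift ψ.2) β
    change ContDiff ℝ (⊤ : ℕ∞) (lift _)
    rw [lift_comp_rep h]
    exact h.contDiff⟩
  map_add' ψ φ := Subtype.ext <| funext fun q =>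
    (smoothPeriodic_lift ψ.2).secondOrder_add (smoothPeriodic_lift φ.2) β (rep q)
  map_smul' c ψ := Subtype.ext <| funext fun q =>
    (smoothPeriodic_lift ψ.2).secondOrder_smul β c (rep q)

lemma rpow_five_halves {dt : ℝ} (hdt : 0 ≤ dt) : dt ^ (5 / 2 : ℝ) = √dt ^ 5 := by
  rw [Real.sqrt_eq_rpow, ← Real.rpow_natCast, ← Real.rpow_mul hdt]
  norm_num

end SecondOrder

end MetropolizedEM

/-! ### Assembly of the two statements. -/

theorem mainTheorem4 (L : ℝ) [Fact (0 < L)] (N d : ℕ) (β : ℝ) (hβ : 0 < β)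
    (V : MetropolizedEM.Torus L N d → ℝ) (hV : V ∈ MetropolizedEM.smoothFunctions L N d) :
    -- expansion of the evolution operator, and invariance
    (∃ A : MetropolizedEM.smoothFunctions L N d →ₗ[ℝ] MetropolizedEM.smoothFunctions L N d,
      (∃ dt₀ : ℝ, 0 < dt₀ ∧
        ∀ ψ : MetropolizedEM.smoothFunctions L N d,
          ∃ r : ℝ → MetropolizedEM.Torus L N d → ℝ,
            (∃ C : ℝ, ∀ dt : ℝ, 0 < dt → dt ≤ dt₀ → ∀ q, |r dt q| ≤ C) ∧
            ∀ dt : ℝ, 0 < dt → dt ≤ dt₀ → ∀ q,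
              MetropolizedEM.evolution β V dt ψ.1 q =
                ψ.1 q + dt * MetropolizedEM.generator β V ψ.1 q + dt ^ 2 * (A ψ).1 q
                  + dt ^ (5 / 2 : ℝ) * r dt q) ∧
      ∀ ψ : MetropolizedEM.smoothFunctions L N d,
        ∫ q, (A ψ).1 q ∂(MetropolizedEM.gibbs β V) = 0) ∧
    -- acceptance probability: before and after averaging over the Gaussian increment
    (∃ (ξ : MetropolizedEM.Torus L N d → MetropolizedEM.Ambient N d → ℝ)
        (ξbar : MetropolizedEM.Torus L N d → ℝ),
      Measurable (Function.uncurry ξ) ∧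
      (∀ q g, 0 ≤ ξ q g) ∧
      (∀ q, MeasureTheory.Integrable (ξ q)
        (ProbabilityTheory.stdGaussian (MetropolizedEM.Ambient N d))) ∧
      (∀ q, ξbar q =
        ∫ g, ξ q g ∂(ProbabilityTheory.stdGaussian (MetropolizedEM.Ambient N d))) ∧
      (∃ K : ℝ, ∀ q, |ξbar q| ≤ K) ∧
      ∀ p : ℕ, ∃ C : ℝ, 0 ≤ C ∧ ∃ dtp : ℝ, 0 < dtp ∧
        ∀ dt : ℝ, 0 < dt → dt ≤ dtp → ∀ q,
          MeasureTheory.Integrable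
            (fun g => |MetropolizedEM.proposalAcceptance β V dt q g - 1
              + dt ^ (3 / 2 : ℝ) * ξ q g| ^ p)
            (ProbabilityTheory.stdGaussian (MetropolizedEM.Ambient N d)) ∧
          ∫ g, |MetropolizedEM.proposalAcceptance β V dt q g - 1
              + dt ^ (3 / 2 : ℝ) * ξ q g| ^ p
            ∂(ProbabilityTheory.stdGaussian (MetropolizedEM.Ambient N d)) ≤ C * dt ^ (2 * p) ∧
          |(∫ g, MetropolizedEM.proposalAcceptance β V dt q g
              ∂(ProbabilityTheory.stdGaussian (MetropolizedEM.Ambient N d))) - 1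
              + dt ^ (3 / 2 : ℝ) * ξbar q| ^ p ≤ C * dt ^ (2 * p)) := by
  have hV' := MetropolizedEM.smoothPeriodic_lift hV
  refine ⟨⟨MetropolizedEM.secondOrderOperator β V hV', ⟨1, one_pos, fun ψ => ?_⟩, fun ψ => ?_⟩, ?_⟩
  · obtain ⟨C, -, hC⟩ :=
      MetropolizedEM.evolution_expansion hV' (MetropolizedEM.smoothPeriodic_lift ψ.2) β
    -- The remainder is defined by solving the expansion for it, so only its bound has content. The
    -- threshold `1` does not depend on `ψ`.
    refine ⟨fun dt q => (MetropolizedEM.evolution β V dt ψ.1 q - (ψ.1 q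
      + dt * MetropolizedEM.generator β V ψ.1 q
      + dt ^ 2 * (MetropolizedEM.secondOrderOperator β V hV' ψ).1 q)) / dt ^ (5 / 2 : ℝ),
      ⟨C, fun dt hdt hdt1 q => ?_⟩, fun dt hdt hdt1 q => ?_⟩
    · have hp : 0 < dt ^ (5 / 2 : ℝ) := Real.rpow_pos_of_pos hdt _
      rw [abs_div, abs_of_pos hp, div_le_iff₀ hp, MetropolizedEM.rpow_five_halves hdt.le]
      exact hC dt hdt hdt1 q
    · rw [mul_div_cancel₀ _ (Real.rpow_pos_of_pos hdt _).ne']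
      ring
  · rw [MetropolizedEM.integral_gibbs hV']
    exact mul_eq_zero_of_right _
      (MetropolizedEM.integral_secondOrder hV' (MetropolizedEM.smoothPeriodic_lift ψ.2) β)
  · obtain ⟨B, -, hB⟩ := hV'.rejectionCoeff_bound β
    have hK : ∀ q : MetropolizedEM.Torus L N d,
        |∫ g, MetropolizedEM.rejectionCoeff β (MetropolizedEM.lift V) (MetropolizedEM.rep q) g
          ∂(ProbabilityTheory.stdGaussian (MetropolizedEM.Ambient N d))| ≤
        B * MetropolizedEM.absMoment (MetropolizedEM.Ambient N d) 3 := fun q =>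
      MetropolizedEM.norm_integral_le_absMoment
        (fun g => (Real.norm_eq_abs _).trans_le (hB (MetropolizedEM.rep q) g))
    refine ⟨fun q g => MetropolizedEM.rejectionCoeff β (MetropolizedEM.lift V)
        (MetropolizedEM.rep q) g, _, MetropolizedEM.measurable_rejectionCoeff hV' β,
      fun q g => le_max_right _ _, MetropolizedEM.integrable_rejectionCoeff hV' β, fun q => rfl,
      ⟨_, hK⟩,
      fun p => ?_⟩
    obtain ⟨C, hC0, hC⟩ := MetropolizedEM.rejection_moments hV' β p
    exact ⟨C, hC0, 1, one_pos, hC⟩
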